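/- An $\alpha/\beta$-staircase tableau of size $n$ is a filling of the Young diagram of shape $(n,n-1,\dots,1)$, with boxes $(i,j)$ (row $i$, column $j$, $i,j\ge 1$, $i+j\le n+1$, counted from the north-west corner), in which each box is empty or contains one symbol $\alpha$ or $\beta$, such that every box with $i+j=n+1$ contains a symbol, all boxes north of an $\alpha$ in the same column are empty, and all boxes west of a $\beta$ in the same row are empty. Let $\mathcal S_n$ be the set of these tableaux. For real parameters $\alpha,\beta>0$ let $\mathrm{wt}(S)$ be the product of all symbols in $S\in\mathcal S_n$, let $Z_n(\alpha,\beta)=\sum_{S\in\mathcal S_n}\mathrm{wt}(S)$, and let the random weighted staircase tableau of size $n$ have the law $\mathbb P_{n,\alpha,\beta}(S)=\mathrm{wt}(S)/Z_n(\alpha,\beta)$. The parameter values $\alpha=\infty$ ($\beta\in(0,\infty)$ fixed), $\beta=\infty$ ($\alpha\in(0,\infty)$ fixed) and $\alpha=\beta=\infty$ are allowed as well: the law is then, for each $n$, the limit of $\mathbb P_{n,\alpha,\beta}$ as $\alpha\to\infty$, as $\beta\to\infty$, and as $\alpha=\beta\to\infty$, respectively (these limits exist). The $k$-th diagonal consists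 of the boxes with $i+j=n-k+2$. Corollary. Let $k>1$ be a fixed integer and let $\alpha,\beta\in(0,\infty]$ be fixed. Let $B_n^{(k)}$ be the number of $\beta$'s on the $k$-th diagonal of a random weighted staircase tableau of size $n$. Then, as $n\to\infty$, \[ B_n^{(k)}\xrightarrow{d}\mathrm{Pois}\left(\tfrac12\right). \] -/

import Mathlib

open Filter Topology MeasureTheory ProbabilityTheory

namespace Staircase

/-- The two symbols that may fill a box of an α/β-staircase tableau. -/
inductive Symbol
  | alpha
  | beta
  deriving DecidableEq

instance : Fintype Symbol :=
  ⟨{Symbol.alpha, Symbol.beta}, fun x => by cases x <;> decide⟩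

/-- The boxes `(i, j)` (row `i`, column `j`, both counted from 1, starting at the north-west
corner) of the Young diagram of shape `n, n - 1, …, 1`. -/
abbrev Box (n : ℕ) : Type :=
  {p : ℕ × ℕ // p ∈ (Finset.Icc 1 n ×ˢ Finset.Icc 1 n).filter (fun p => p.1 + p.2 ≤ n + 1)}

/-- The row of a box. -/
def Box.row {n : ℕ} (x : Box n) : ℕ := x.1.1

/-- The column of a box. -/
def Box.col {n : ℕ} (x : Box n) : ℕ := x.1.2

/-- The box `(i, j)` lies on the `k`-th diagonal when `i + j = n - k + 2`
(written without subtraction). The first diagonal is the outer one, `i + j = n + 1`. -/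
def Box.OnDiagonal {n : ℕ} (k : ℕ) (x : Box n) : Prop := x.row + x.col + k = n + 2

instance {n : ℕ} (k : ℕ) (x : Box n) : Decidable (x.OnDiagonal k) :=
  inferInstanceAs (Decidable (_ = _))

/-- An α/β-staircase tableau of size `n`; `none` is an empty box. -/
@[ext]
structure Tableau (n : ℕ) where
  /-- The content of each box. -/
  fill : Box n → Option Symbol
  /-- Every box of the first diagonal contains a symbol. -/
  diagonal_filled : ∀ x : Box n, x.OnDiagonal 1 → fill x ≠ none
  /-- The boxes in the same column as an α and north of it are empty. -/
  north_of_alpha : ∀ x y : Box n, fill x = some Symbol.alpha →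
    y.col = x.col → y.row < x.row → fill y = none
  /-- The boxes in the same row as a β and west of it are empty. -/
  west_of_beta : ∀ x y : Box n, fill x = some Symbol.beta →
    y.row = x.row → y.col < x.col → fill y = none

noncomputable instance (n : ℕ) : Fintype (Tableau n) :=
  Fintype.ofInjective Tableau.fill (fun _ _ h => Tableau.ext h)

/-- Every set of tableaux is an event. -/
instance (n : ℕ) : MeasurableSpace (Tableau n) := ⊤

instance (n : ℕ) : DiscreteMeasurableSpace (Tableau n) := ⟨fun _ => trivial⟩

/-- The factor that a box contributes to the weight. -/
def symbolWeight (α β : ℝ) : Option Symbol → ℝ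
  | none => 1
  | some Symbol.alpha => α
  | some Symbol.beta => β

/-- The weight of a tableau: the product of all its symbols. -/
noncomputable def Tableau.weight {n : ℕ} (α β : ℝ) (S : Tableau n) : ℝ :=
  ∏ x : Box n, symbolWeight α β (S.fill x)

/-- The partition function `Z_n(α, β)`. -/
noncomputable def partitionFunction (n : ℕ) (α β : ℝ) : ℝ :=
  ∑ S : Tableau n, S.weight α β

/-- The probability `wt(S) / Z_n(α, β)` of the tableau `S`. -/
noncomputable def tableauProb (n : ℕ) (α β : ℝ) (S : Tableau n) : ℝ :=
  S.weight α β / partitionFunction n α β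

/-- The tableau with an α in each box of the first diagonal and no other symbol. -/
def alphaTableau (n : ℕ) : Tableau n where
  fill x := if x.OnDiagonal 1 then some Symbol.alpha else none
  diagonal_filled x hx := by simp [hx]
  north_of_alpha x y hx hc hr := by
    have h1 : x.OnDiagonal 1 := by
      by_contra h
      simp [h] at hx
    have h2 : ¬ y.OnDiagonal 1 := by
      unfold Box.OnDiagonal at *
      omega
    simp [h2]
  west_of_beta x y hx := by
    split_ifs at hx
    simp at hx

theorem Tableau.weight_pos {n : ℕ} {α β : ℝ} (hα : 0 < α) (hβ : 0 < β) (S : Tableau n) :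
    0 < S.weight α β := by
  refine Finset.prod_pos fun x _ => ?_
  rcases S.fill x with _ | _ | _
  · exact one_pos
  · exact hα
  · exact hβ

theorem partitionFunction_pos (n : ℕ) {α β : ℝ} (hα : 0 < α) (hβ : 0 < β) :
    0 < partitionFunction n α β :=
  Finset.sum_pos (fun S _ => S.weight_pos hα hβ) ⟨alphaTableau n, Finset.mem_univ _⟩

/-- The law `ℙ_{n,α,β}` of the random weighted tableau of size `n`, for finite parameters. -/
noncomputable def law (n : ℕ) (α β : ℝ) (hα : 0 < α) (hβ : 0 < β) : PMF (Tableau n) :=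
  PMF.ofFintype (fun S => ENNReal.ofReal (tableauProb n α β S)) (by
    have hZ := partitionFunction_pos n hα hβ
    unfold tableauProb
    rw [← ENNReal.ofReal_sum_of_nonneg
      (fun S _ => div_nonneg (S.weight_pos hα hβ).le hZ.le), ← Finset.sum_div]
    change ENNReal.ofReal (partitionFunction n α β / partitionFunction n α β) = 1
    rw [div_self hZ.ne', ENNReal.ofReal_one])

/-- `P` is the family of limit laws of the random weighted tableaux when the parameters
`(α t, β t)` move along `t → ∞`: for each size `n`, the probability of each tableau is the limit
of its probabilities under `ℙ_{n, α t, β t}`. Such a family `P` is unique. -/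
def IsLimitLaw (α β : ℝ → ℝ) (P : (n : ℕ) → PMF (Tableau n)) : Prop :=
  ∀ (n : ℕ) (S : Tableau n),
    Tendsto (fun t => tableauProb n (α t) (β t) S) atTop (𝓝 (P n S).toReal)

/-- The number of β's on the `k`-th diagonal of a tableau. -/
def betaCount (k : ℕ) {n : ℕ} (S : Tableau n) : ℕ :=
  (Finset.univ.filter (fun x : Box n => x.OnDiagonal k ∧ S.fill x = some Symbol.beta)).card

end Staircase

/-! Put a = 1/α and b = 1/β. A column holds at most one α and a row at most one β, so a tableau has
weight (αβ)^n a^(columns without α) b^(rows without β) (`weight_eq`). A new top row amounts to a set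
T of α-free columns in which it is nonempty, besides its last box, and its leftmost symbol; all its
other symbols are α (`sum_succ`). By the binomial theorem over T, removing the top row turns the law
with parameters (a, b) into the one with (a + 1, b) (`expect_tail`). This preserves s = a + b + n.

Let k = κ + 2 and let j be the column where the top row of a tableau of size n = j + κ + 2 meets the
k-th diagonal. If that box holds a β, then, apart from an event of probability O(1/((1 + a)s))
(`expect_crowded_le`), the top row is otherwise empty except for its last box, column j has no
further symbol but a β at its foot, and the diagonal carries no β in the rows down to that foot.
This configuration has probability exactly a/((s - 1)(s - 2)), and removing its κ + 2 rows leaves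
the law of size j with parameters (a + κ, b). Hence the probabilities p_m of m β's satisfy p_m(n, a)
- p_m(n - 1, a + 1) ≈ a/((s - 1)(s - 2)) · (p_{m-1} - p_m)(j, a + κ) (`abs_betaProb_succ_sub_le`).

The Poisson probabilities of mean u(x) = x - x²/2 at x = n/s obey the same recursion up to O(1/s²)
(`poisson_consistency`), because u'(x) = 1 - x = (a + b)/s. Along a, a + 1, a + 2, … with s fixed,
errors of order 1/((1 + a)s) have a small sum, and an induction yields a distance O(1/√s)
(`abs_betaProb_sub_poissonProb_le`). For bounded a and b, x → 1 and u → 1/2. The estimate is uniform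
in small a and b, so it passes to the limit laws at infinite parameters. -/

namespace Staircase

/-! ### Zero-based access to the boxes -/

namespace Tableau

variable {n : ℕ}

/-- The content of the box in row `i` and column `j`, both counted from `0`; `none` outside of the
diagram. -/
def get (S : Tableau n) (i j : ℕ) : Option Symbol :=
  if h : i + j < n then
    S.fill ⟨(i + 1, j + 1), by simp only [Finset.mem_filter, Finset.mem_product, Finset.mem_Icc]; omega⟩
  else none

theorem get_of_le (S : Tableau n) {i j : ℕ} (h : n ≤ i + j) : S.get i j = none :=
  dif_neg (by omega)

theorem lt_of_get (S : Tableau n) {i j : ℕ} (h : S.get i j ≠ none) : i + j < n := by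
  by_contra h'
  exact h (S.get_of_le (by omega))

theorem fill_eq_get (S : Tableau n) (x : Box n) : S.fill x = S.get (x.row - 1) (x.col - 1) := by
  obtain ⟨⟨i, j⟩, hx⟩ := x
  have h := hx
  simp only [Finset.mem_filter, Finset.mem_product, Finset.mem_Icc] at h
  obtain ⟨i, rfl⟩ : ∃ i', i = i' + 1 := ⟨i - 1, by omega⟩
  obtain ⟨j, rfl⟩ : ∃ j', j = j' + 1 := ⟨j - 1, by omega⟩
  simp only [Box.row, Box.col, Nat.add_sub_cancel]
  rw [get, dif_pos (by omega)]

theorem box_bounds (x : Box n) : 1 ≤ x.row ∧ 1 ≤ x.col ∧ x.row + x.col ≤ n + 1 := by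
  have h := x.2
  simp only [Finset.mem_filter, Finset.mem_product, Finset.mem_Icc] at h
  exact ⟨h.1.1.1, h.1.2.1, h.2⟩

theorem get_diagonal (S : Tableau n) {i j : ℕ} (h : i + j + 1 = n) : S.get i j ≠ none := by
  rw [get, dif_pos (by omega)]
  exact S.diagonal_filled _ (by simp only [Box.OnDiagonal, Box.row, Box.col]; omega)

theorem get_north (S : Tableau n) {i i' j : ℕ} (h : S.get i j = some Symbol.alpha) (hi : i' < i) :
    S.get i' j = none := by
  have hlt := S.lt_of_get (i := i) (j := j) (by simp [h])
  rw [get, dif_pos hlt] at h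
  rw [get, dif_pos (by omega)]
  exact S.north_of_alpha _ _ h rfl (by simp only [Box.row]; omega)

theorem get_west (S : Tableau n) {i j j' : ℕ} (h : S.get i j = some Symbol.beta) (hj : j' < j) :
    S.get i j' = none := by
  have hlt := S.lt_of_get (i := i) (j := j) (by simp [h])
  rw [get, dif_pos hlt] at h
  rw [get, dif_pos (by omega)]
  exact S.west_of_beta _ _ h rfl (by simp only [Box.col]; omega)

theorem ext_get {S S' : Tableau n} (h : ∀ i j, i + j < n → S.get i j = S'.get i j) : S = S' := by
  ext1
  funext x
  have hx := box_bounds x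
  rw [fill_eq_get, fill_eq_get]
  exact h _ _ (by omega)

/-- The tableau with prescribed contents. -/
def ofFun (f : ℕ → ℕ → Option Symbol) (h1 : ∀ i j, i + j + 1 = n → f i j ≠ none)
    (h2 : ∀ i i' j, i + j < n → f i j = some Symbol.alpha → i' < i → f i' j = none)
    (h3 : ∀ i j j', i + j < n → f i j = some Symbol.beta → j' < j → f i j' = none) :
    Tableau n where
  fill x := f (x.row - 1) (x.col - 1)
  diagonal_filled x hx := by
    have := box_bounds x
    unfold Box.OnDiagonal at hx
    exact h1 _ _ (by omega)
  north_of_alpha x y hx hc hr := by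
    have := box_bounds x
    have := box_bounds y
    rw [hc]
    exact h2 _ _ _ (by omega) hx (by omega)
  west_of_beta x y hx hc hr := by
    have := box_bounds x
    have := box_bounds y
    rw [hc]
    exact h3 _ _ _ (by omega) hx (by omega)

theorem get_ofFun {f : ℕ → ℕ → Option Symbol} {h1 h2 h3} {i j : ℕ} (h : i + j < n) :
    (ofFun (n := n) f h1 h2 h3).get i j = f i j := by
  rw [get, dif_pos h]
  simp [ofFun, Box.row, Box.col]

/-- Removal of the top row. -/
def tail (S : Tableau (n + 1)) : Tableau n :=
  ofFun (fun i j => S.get (i + 1) j) (fun i j h => S.get_diagonal (by omega))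
    (fun i i' j _ h hi => S.get_north h (by omega)) (fun i j j' _ h hj => S.get_west h hj)

@[simp]
theorem get_tail (S : Tableau (n + 1)) (i j : ℕ) : S.tail.get i j = S.get (i + 1) j := by
  by_cases h : i + j < n
  · exact get_ofFun h
  · rw [get_of_le _ (by omega), get_of_le _ (by omega)]

open Classical in
/-- The columns without an α. -/
noncomputable def free (S : Tableau n) : Finset ℕ :=
  (Finset.range n).filter fun j => ∀ i, S.get i j ≠ some Symbol.alpha

open Classical in
/-- The number of rows without a β. -/
noncomputable def freeRows (S : Tableau n) : ℕ :=
  ∑ i ∈ Finset.range n, if ∀ j, S.get i j ≠ some Symbol.beta then 1 else 0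

theorem mem_free {S : Tableau n} {j : ℕ} :
    j ∈ S.free ↔ j < n ∧ ∀ i, S.get i j ≠ some Symbol.alpha := by
  simp [free]

theorem free_subset (S : Tableau n) : S.free ⊆ Finset.range n :=
  fun _ h => Finset.mem_range.2 (mem_free.1 h).1

/-! ### Adding a top row -/

/-- The leftmost nonempty box of the top row whose nonempty boxes are `T` and the last one. -/
def leftmost (n : ℕ) (T : Finset ℕ) : ℕ := (insert n T).min' (Finset.insert_nonempty _ _)

theorem leftmost_mem (n : ℕ) (T : Finset ℕ) : leftmost n T ∈ insert n T := Finset.min'_mem _ _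

theorem leftmost_le {n : ℕ} {T : Finset ℕ} {j : ℕ} (h : j ∈ insert n T) : leftmost n T ≤ j :=
  Finset.min'_le _ _ h

@[simp]
theorem leftmost_empty (n : ℕ) : leftmost n ∅ = n := by simp [leftmost]

theorem leftmost_singleton {n j : ℕ} (h : j < n) : leftmost n {j} = j := by
  have h1 : leftmost n {j} ≤ j := leftmost_le (by simp)
  have h2 := leftmost_mem n {j}
  simp only [Finset.mem_insert, Finset.mem_singleton] at h2
  omega

/-- The top row whose nonempty boxes are `T` and the last one, with leftmost symbol `e` and all
other symbols α. -/
def topRow (n : ℕ) (T : Finset ℕ) (e : Symbol) (j : ℕ) : Option Symbol :=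
  if j = leftmost n T then some e else if j ∈ insert n T then some Symbol.alpha else none

theorem topRow_ne_none {n : ℕ} {T : Finset ℕ} {e : Symbol} {j : ℕ} :
    topRow n T e j ≠ none ↔ j = n ∨ j ∈ T := by
  have := leftmost_mem n T
  rw [← Finset.mem_insert]
  unfold topRow
  split_ifs with h1 h2
  · simp [h1, this]
  · simp [h2]
  · simp [h2]

theorem topRow_eq_beta {n : ℕ} {T : Finset ℕ} {e : Symbol} {j : ℕ} :
    topRow n T e j = some Symbol.beta ↔ j = leftmost n T ∧ e = Symbol.beta := by
  unfold topRow
  split_ifs with h1 h2 <;> simp [h1]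

/-- Addition of a top row. -/
noncomputable def cons (S : Tableau n) (T : Finset ℕ) (e : Symbol) : Tableau (n + 1) :=
  -- Intersecting with the free columns makes the construction total; it changes nothing for the
  -- sets T that are used later.
  ofFun (fun i j => if i = 0 then topRow n (T ∩ S.free) e j else S.get (i - 1) j)
    (fun i j h => by
      split_ifs with hi
      · exact topRow_ne_none.2 (Or.inl (by omega))
      · exact S.get_diagonal (by omega))
    (fun i i' j hij h hi => by
      rw [if_neg (by omega)] at h
      have hlt := S.lt_of_get (i := i - 1) (j := j) (by simp [h])
      split_ifs with hi'
      · by_contra hne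
        rcases topRow_ne_none.1 hne with h1 | h1
        · omega
        · exact (mem_free.1 (Finset.mem_inter.1 h1).2).2 _ h
      · exact S.get_north h (by omega))
    (fun i j j' hij h hj => by
      split_ifs at h ⊢ with hi
      · by_contra hne
        have := leftmost_le (Finset.mem_insert.2 (topRow_ne_none.1 hne))
        have := (topRow_eq_beta.1 h).1
        omega
      · exact S.get_west h hj)

theorem get_cons_zero (S : Tableau n) {T : Finset ℕ} (hT : T ⊆ S.free) (e : Symbol) (j : ℕ) :
    (S.cons T e).get 0 j = topRow n T e j := by
  by_cases h : 0 + j < n + 1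
  · rw [cons, get_ofFun h, if_pos rfl, Finset.inter_eq_left.2 hT]
  · rw [get_of_le _ (by omega)]
    by_contra hne
    rcases topRow_ne_none.1 (Ne.symm hne) with h1 | h1
    · omega
    · have := (mem_free.1 (hT h1)).1
      omega

@[simp]
theorem get_cons_succ (S : Tableau n) (T : Finset ℕ) (e : Symbol) (i j : ℕ) :
    (S.cons T e).get (i + 1) j = S.get i j := by
  by_cases h : i + 1 + j < n + 1
  · rw [cons, get_ofFun h, if_neg (by omega), Nat.add_sub_cancel]
  · rw [get_of_le _ (by omega), get_of_le _ (by omega)]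

@[simp]
theorem tail_cons (S : Tableau n) (T : Finset ℕ) (e : Symbol) : (S.cons T e).tail = S :=
  ext_get fun i j _ => by simp

theorem get_cons_zero_ne_none (S : Tableau n) {T : Finset ℕ} (hT : T ⊆ S.free) (e : Symbol)
    {j : ℕ} (hj : j < n) : (S.cons T e).get 0 j ≠ none ↔ j ∈ T := by
  rw [get_cons_zero S hT, topRow_ne_none]
  exact or_iff_right (by omega)

open Classical in
/-- The nonempty boxes of the top row, except for the last one. -/
noncomputable def topSet (S : Tableau (n + 1)) : Finset ℕ :=
  (Finset.range n).filter fun j => S.get 0 j ≠ none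

theorem mem_topSet {S : Tableau (n + 1)} {j : ℕ} : j ∈ S.topSet ↔ j < n ∧ S.get 0 j ≠ none := by
  simp [topSet]

open Classical in
/-- The leftmost symbol of the top row. -/
noncomputable def topSymbol (S : Tableau (n + 1)) : Symbol :=
  if ∃ j, S.get 0 j = some Symbol.beta then Symbol.beta else Symbol.alpha

/-- An α further down a column would empty the top box of that column. -/
theorem topSet_subset (S : Tableau (n + 1)) : S.topSet ⊆ S.tail.free := by
  intro j hj
  rw [mem_topSet] at hj
  refine mem_free.2 ⟨hj.1, fun i h => hj.2 ?_⟩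
  rw [get_tail] at h
  exact S.get_north h (by omega)

theorem topSet_cons (S : Tableau n) {T : Finset ℕ} (hT : T ⊆ S.free) (e : Symbol) :
    (S.cons T e).topSet = T := by
  ext j
  rw [mem_topSet]
  constructor
  · rintro ⟨h1, h2⟩
    exact (get_cons_zero_ne_none S hT e h1).1 h2
  · intro h
    have h1 := (mem_free.1 (hT h)).1
    exact ⟨h1, (get_cons_zero_ne_none S hT e h1).2 h⟩

theorem topSymbol_cons (S : Tableau n) {T : Finset ℕ} (hT : T ⊆ S.free) (e : Symbol) :
    (S.cons T e).topSymbol = e := by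
  unfold topSymbol
  cases e with
  | alpha => exact if_neg (by simp [get_cons_zero S hT, topRow_eq_beta])
  | beta => exact if_pos ⟨leftmost n T, by simp [get_cons_zero S hT, topRow_eq_beta]⟩

/-- A β in the top row has only empty boxes to its west, so it is the leftmost symbol and the only
β. The row is therefore determined by its nonempty boxes and its leftmost symbol. -/
theorem cons_tail (S : Tableau (n + 1)) : S.tail.cons S.topSet S.topSymbol = S := by
  refine ext_get fun i j hij => ?_
  cases i with
  | succ i => simp
  | zero =>
    rw [get_cons_zero _ S.topSet_subset]
    have key : ∀ j', S.get 0 j' ≠ none ↔ j' ∈ insert n S.topSet := fun j' => by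
      rw [Finset.mem_insert, mem_topSet]
      constructor
      · intro h
        have := S.lt_of_get h
        by_cases h' : j' = n
        · exact Or.inl h'
        · exact Or.inr ⟨by omega, h⟩
      · rintro (rfl | h)
        · exact S.get_diagonal (by omega)
        · exact h.2
    unfold topRow
    by_cases hb : ∃ j, S.get 0 j = some Symbol.beta
    · have hs : S.topSymbol = Symbol.beta := if_pos hb
      obtain ⟨j0, hj0⟩ := hb
      have h0 : j0 = leftmost n S.topSet := by
        have h1 : leftmost n S.topSet ≤ j0 := leftmost_le ((key j0).1 (by simp [hj0]))
        have h2 := (key _).2 (leftmost_mem n S.topSet)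
        by_contra hne
        exact h2 (S.get_west hj0 (by omega))
      rw [hs]
      split_ifs with h1 h2
      · rw [h1, ← h0, hj0]
      · rw [← key] at h2
        rcases hg : S.get 0 j with _ | _ | _
        · exact absurd hg h2
        · rfl
        · exfalso
          rcases lt_trichotomy j j0 with h | h | h
          · exact h2 (S.get_west hj0 h)
          · exact h1 (h.trans h0)
          · have := S.get_west hg h
            simp [hj0] at this
      · rw [← key] at h2
        simpa using (not_not.1 h2).symm
    · have hs : S.topSymbol = Symbol.alpha := if_neg hb
      rw [hs]
      have hl := leftmost_mem n S.topSet
      split_ifs with h1 h2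
      · rw [← h1, ← key] at hl
        rcases hg : S.get 0 j with _ | _ | _
        · exact absurd hg hl
        · rfl
        · exact absurd ⟨j, hg⟩ hb
      · rw [← key] at h2
        rcases hg : S.get 0 j with _ | _ | _
        · exact absurd hg h2
        · rfl
        · exact absurd ⟨j, hg⟩ hb
      · rw [← key] at h2
        simpa using (not_not.1 h2).symm

theorem sum_succ {M : Type*} [AddCommMonoid M] (f : Tableau (n + 1) → M) :
    ∑ S, f S = ∑ S : Tableau n, ∑ T ∈ S.free.powerset,
      (f (S.cons T Symbol.alpha) + f (S.cons T Symbol.beta)) := by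
  have h : ∀ g : Symbol → M, g Symbol.alpha + g Symbol.beta = ∑ e, g e := fun g => by
    change _ = ∑ e ∈ {Symbol.alpha, Symbol.beta}, g e
    rw [Finset.sum_pair (by simp)]
  simp_rw [fun (S : Tableau n) (T : Finset ℕ) => h fun e => f (S.cons T e)]
  simp_rw [← Finset.sum_product']
  rw [Finset.sum_sigma']
  refine Finset.sum_nbij' (fun S => ⟨S.tail, (S.topSet, S.topSymbol)⟩)
    (fun x => x.1.cons x.2.1 x.2.2) ?_ ?_ ?_ ?_ ?_
  · intro S _
    simp [S.topSet_subset]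
  · simp
  · intro S _
    exact S.cons_tail
  · rintro ⟨S, T, e⟩ h
    simp only [Finset.mem_sigma, Finset.mem_univ, Finset.mem_product, Finset.mem_powerset,
      true_and, and_true] at h
    simp [topSet_cons S h, topSymbol_cons S h]
  · intro S _
    simp [S.cons_tail]

/-! ### Statistics of a tableau with an added row -/

theorem not_mem_free_self (S : Tableau n) : n ∉ S.free := fun h => by
  simpa using (mem_free.1 h).1

theorem free_cons_alpha (S : Tableau n) {T : Finset ℕ} (hT : T ⊆ S.free) :
    (S.cons T Symbol.alpha).free = S.free \ T := by
  ext j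
  rw [mem_free, Finset.mem_sdiff, mem_free]
  constructor
  · rintro ⟨h1, h2⟩
    have h0 := h2 0
    rw [get_cons_zero S hT] at h0
    have hj : ¬ (j = n ∨ j ∈ T) := fun h => by
      have h3 := topRow_ne_none (e := Symbol.alpha).2 h
      unfold topRow at h0 h3
      split_ifs at h0 h3 <;> simp_all
    push Not at hj
    refine ⟨⟨by omega, fun i => ?_⟩, hj.2⟩
    simpa using h2 (i + 1)
  · rintro ⟨⟨h1, h2⟩, h3⟩
    refine ⟨by omega, fun i => ?_⟩
    cases i with
    | succ i => simpa using h2 i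
    | zero =>
      rw [get_cons_zero S hT]
      have : topRow n T Symbol.alpha j = none := by
        by_contra h
        rcases topRow_ne_none.1 h with h | h
        · omega
        · exact h3 h
      simp [this]

/-- The column under the β had no α and receives none, so it remains free. For empty T this is the
new column n. -/
theorem free_cons_beta (S : Tableau n) {T : Finset ℕ} (hT : T ⊆ S.free) :
    (S.cons T Symbol.beta).free = insert (leftmost n T) (S.free \ T) := by
  have hl := leftmost_mem n T
  have hl' : leftmost n T < n + 1 ∧ ∀ i, S.get i (leftmost n T) ≠ some Symbol.alpha := by
    rcases Finset.mem_insert.1 hl with h | h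
    · rw [h]
      exact ⟨by omega, fun i => by simp [S.get_of_le (i := i) (j := n) (by omega)]⟩
    · have := mem_free.1 (hT h)
      exact ⟨by omega, this.2⟩
  ext j
  rw [mem_free, Finset.mem_insert, Finset.mem_sdiff, mem_free]
  constructor
  · rintro ⟨h1, h2⟩
    by_cases hj : j = leftmost n T
    · exact Or.inl hj
    have h0 := h2 0
    rw [get_cons_zero S hT] at h0
    have hj' : ¬ (j = n ∨ j ∈ T) := fun h => by
      rw [← Finset.mem_insert] at h
      simp [topRow, hj, h] at h0
    push Not at hj'
    refine Or.inr ⟨⟨by omega, fun i => ?_⟩, hj'.2⟩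
    simpa using h2 (i + 1)
  · rintro (rfl | ⟨⟨h1, h2⟩, h3⟩)
    · refine ⟨hl'.1, fun i => ?_⟩
      cases i with
      | succ i => simpa using hl'.2 i
      | zero => simp [get_cons_zero S hT, topRow]
    · refine ⟨by omega, fun i => ?_⟩
      cases i with
      | succ i => simpa using h2 i
      | zero =>
        rw [get_cons_zero S hT]
        have : topRow n T Symbol.beta j = none := by
          by_contra h
          rcases topRow_ne_none.1 h with h | h
          · omega
          · exact h3 h
        simp [this]

theorem card_free_cons_alpha (S : Tableau n) {T : Finset ℕ} (hT : T ⊆ S.free) :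
    (S.cons T Symbol.alpha).free.card = S.free.card - T.card := by
  rw [free_cons_alpha S hT, Finset.card_sdiff_of_subset hT]

theorem card_free_cons_beta (S : Tableau n) {T : Finset ℕ} (hT : T ⊆ S.free) :
    (S.cons T Symbol.beta).free.card = S.free.card - T.card + 1 := by
  rw [free_cons_beta S hT, Finset.card_insert_of_notMem, Finset.card_sdiff_of_subset hT]
  intro h
  rw [Finset.mem_sdiff] at h
  rcases Finset.mem_insert.1 (leftmost_mem n T) with h' | h'
  · rw [h'] at h
    exact S.not_mem_free_self h.1
  · exact h.2 h'

theorem freeRows_cons (S : Tableau n) {T : Finset ℕ} (hT : T ⊆ S.free) (e : Symbol) :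
    (S.cons T e).freeRows = S.freeRows + if e = Symbol.alpha then 1 else 0 := by
  classical
  rw [freeRows, Finset.sum_range_succ', freeRows]
  congr 1
  · exact Finset.sum_congr rfl fun i _ => if_congr (by simp) rfl rfl
  · exact if_congr (by cases e <;> simp [get_cons_zero S hT, topRow_eq_beta]) rfl rfl

end Tableau
namespace Tableau

variable {n : ℕ}

/-! ### The weight in terms of the free rows and columns -/

/-- Boxes outside the diagram read as empty and have weight 1, so the product may run over a full
square, which splits by rows. -/
theorem weight_eq_prod (α β : ℝ) (S : Tableau n) :
    S.weight α β =
      ∏ i ∈ Finset.range n, ∏ j ∈ Finset.range n, symbolWeight α β (S.get i j) := by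
  have h1 : S.weight α β = ∏ p ∈ (Finset.Icc 1 n ×ˢ Finset.Icc 1 n).filter
      (fun p => p.1 + p.2 ≤ n + 1), symbolWeight α β (S.get (p.1 - 1) (p.2 - 1)) := by
    rw [← Finset.prod_coe_sort]
    exact Finset.prod_congr rfl fun x _ => by rw [S.fill_eq_get]; rfl
  have h2 : ∏ i ∈ Finset.range n, ∏ j ∈ Finset.range n, symbolWeight α β (S.get i j) =
      ∏ p ∈ (Finset.range n ×ˢ Finset.range n).filter (fun p => p.1 + p.2 < n),
        symbolWeight α β (S.get p.1 p.2) := by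
    rw [Finset.prod_filter_of_ne, Finset.prod_product]
    intro p _ hp
    by_contra h
    rw [S.get_of_le (by omega)] at hp
    exact hp rfl
  rw [h1, h2]
  refine Finset.prod_nbij' (fun p => (p.1 - 1, p.2 - 1)) (fun p => (p.1 + 1, p.2 + 1))
    ?_ ?_ ?_ ?_ ?_
  · intro p hp
    simp only [Finset.mem_filter, Finset.mem_product, Finset.mem_Icc, Finset.mem_range] at hp ⊢
    omega
  · intro p hp
    simp only [Finset.mem_filter, Finset.mem_product, Finset.mem_Icc, Finset.mem_range] at hp ⊢
    omega
  · intro p hp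
    simp only [Finset.mem_filter, Finset.mem_product, Finset.mem_Icc] at hp
    ext <;> simp only <;> omega
  · intro p _
    simp
  · intro p _
    rfl

theorem weight_cons (α β : ℝ) (S : Tableau n) {T : Finset ℕ} (hT : T ⊆ S.free) (e : Symbol) :
    (S.cons T e).weight α β = S.weight α β * (symbolWeight α β (some e) * α ^ T.card) := by
  rw [weight_eq_prod, weight_eq_prod, Finset.prod_range_succ']
  congr 1
  · refine Finset.prod_congr rfl fun i _ => ?_
    rw [Finset.prod_range_succ, get_cons_succ, S.get_of_le (by omega)]
    simp [symbolWeight]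
  · have hn : n ∉ T := fun h => S.not_mem_free_self (hT h)
    have hsub : insert n T ⊆ Finset.range (n + 1) := by
      intro j hj
      rw [Finset.mem_range]
      rcases Finset.mem_insert.1 hj with h | h
      · omega
      · have := (mem_free.1 (hT h)).1
        omega
    simp_rw [get_cons_zero S hT]
    rw [← Finset.prod_subset hsub, ← Finset.mul_prod_erase _ _ (leftmost_mem n T)]
    · congr 1
      · simp [topRow]
      · rw [Finset.prod_congr rfl (g := fun _ => α), Finset.prod_const,
          Finset.card_erase_of_mem (leftmost_mem n T), Finset.card_insert_of_notMem hn,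
          Nat.add_sub_cancel]
        intro j hj
        rw [Finset.mem_erase] at hj
        simp [topRow, hj.1, hj.2, symbolWeight]
    · intro j _ hj
      have : topRow n T e j = none := by
        by_contra h
        exact hj (Finset.mem_insert.2 (topRow_ne_none.1 h))
      simp [this, symbolWeight]

theorem card_le_of_subset_free {S : Tableau n} {T : Finset ℕ} (hT : T ⊆ S.free) :
    T.card ≤ S.free.card := Finset.card_le_card hT

/-- The exponents count the columns without their one possible α and the rows without their one
possible β. The induction adds one row at a time. -/
theorem weight_eq {α β : ℝ} (hα : 0 < α) (hβ : 0 < β) (S : Tableau n) :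
    S.weight α β = (α * β) ^ n * (α⁻¹ ^ S.free.card * β⁻¹ ^ S.freeRows) := by
  induction n with
  | zero =>
    have : S.free = ∅ := Finset.subset_empty.1 (by simpa using S.free_subset)
    simp [weight_eq_prod, freeRows, this]
  | succ n ih =>
    obtain ⟨T, e, hT, hS⟩ : ∃ T e, T ⊆ S.tail.free ∧ S = S.tail.cons T e :=
      ⟨_, _, S.topSet_subset, S.cons_tail.symm⟩
    generalize S.tail = S' at hT hS
    subst hS
    -- Writing the number of free columns as |T| + d removes the truncated subtraction.
    obtain ⟨d, hd⟩ := Nat.exists_eq_add_of_le (card_le_of_subset_free hT)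
    rw [weight_cons _ _ _ hT, ih, freeRows_cons _ hT]
    cases e with
    | alpha =>
      rw [card_free_cons_alpha _ hT, hd, Nat.add_sub_cancel_left]
      simp only [symbolWeight, if_true, inv_pow]
      field_simp
      ring
    | beta =>
      rw [card_free_cons_beta _ hT, hd, Nat.add_sub_cancel_left]
      simp only [symbolWeight, inv_pow, reduceCtorEq, if_false]
      field_simp
      ring

end Tableau

/-! ### Indicators -/

open Classical in
/-- The indicator of a proposition. -/
noncomputable def ind (p : Prop) : ℝ := if p then 1 else 0

theorem ind_of {p : Prop} (h : p) : ind p = 1 := if_pos h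

theorem ind_of_not {p : Prop} (h : ¬p) : ind p = 0 := if_neg h

theorem ind_nonneg (p : Prop) : 0 ≤ ind p := by
  unfold ind
  split_ifs <;> norm_num

theorem ind_le_one (p : Prop) : ind p ≤ 1 := by
  unfold ind
  split_ifs <;> norm_num

theorem ind_mono {p q : Prop} (h : p → q) : ind p ≤ ind q := by
  by_cases hp : p
  · rw [ind_of hp, ind_of (h hp)]
  · rw [ind_of_not hp]
    exact ind_nonneg q

theorem ind_mul (p q : Prop) : ind p * ind q = ind (p ∧ q) := by
  by_cases hp : p <;> by_cases hq : q <;> simp [ind, hp, hq]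

/-! ### Expectations in terms of the inverse parameters -/

/-- The normalising constant in terms of the inverse parameters. -/
noncomputable def normConst (n : ℕ) (a b : ℝ) : ℝ := ∏ i ∈ Finset.range n, (a + b + i)

/-- The probability of a tableau in terms of the inverse parameters `a = α⁻¹` and `b = β⁻¹`. -/
noncomputable def prob {n : ℕ} (a b : ℝ) (S : Tableau n) : ℝ :=
  a ^ S.free.card * b ^ S.freeRows / normConst n a b

/-- The expectation of `Φ` in terms of the inverse parameters. -/
noncomputable def expect (n : ℕ) (a b : ℝ) (Φ : Tableau n → ℝ) : ℝ :=
  ∑ S, prob a b S * Φ S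

variable {n : ℕ} {a b : ℝ}

theorem normConst_pos (ha : 0 < a) (hb : 0 < b) : 0 < normConst n a b :=
  Finset.prod_pos fun i _ => by positivity

theorem prob_nonneg (ha : 0 < a) (hb : 0 < b) (S : Tableau n) : 0 ≤ prob a b S :=
  div_nonneg (by positivity) (normConst_pos ha hb).le

/-- Splitting off the factor i = 0 shifts a by one; this serves sums over all top rows. Splitting
off the last factor keeps a; this serves a single prescribed top row. -/
theorem normConst_succ (n : ℕ) (a b : ℝ) :
    normConst (n + 1) a b = (a + b) * normConst n (a + 1) b := by
  rw [normConst, Finset.prod_range_succ', mul_comm, normConst]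
  congr 1
  · simp
  · exact Finset.prod_congr rfl fun i _ => by push_cast; ring

theorem normConst_succ' (n : ℕ) (a b : ℝ) :
    normConst (n + 1) a b = normConst n a b * (a + b + n) := Finset.prod_range_succ _ _

theorem expect_succ (Φ : Tableau (n + 1) → ℝ) :
    expect (n + 1) a b Φ = (∑ S : Tableau n, b ^ S.freeRows * ∑ T ∈ S.free.powerset,
      a ^ (S.free.card - T.card) * (b * Φ (S.cons T Symbol.alpha) +
        a * Φ (S.cons T Symbol.beta))) / normConst (n + 1) a b := by
  rw [expect, Tableau.sum_succ, Finset.sum_div]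
  refine Finset.sum_congr rfl fun S _ => ?_
  rw [Finset.mul_sum, Finset.sum_div]
  refine Finset.sum_congr rfl fun T hT => ?_
  rw [Finset.mem_powerset] at hT
  simp only [prob, Tableau.card_free_cons_alpha S hT, Tableau.card_free_cons_beta S hT,
    Tableau.freeRows_cons S hT, if_true, reduceCtorEq, if_false]
  ring

theorem expect_congr {Φ Ψ : Tableau n → ℝ} (h : ∀ S, Φ S = Ψ S) :
    expect n a b Φ = expect n a b Ψ := by
  rw [funext h]

theorem expect_mono (ha : 0 < a) (hb : 0 < b) {Φ Ψ : Tableau n → ℝ} (h : ∀ S, Φ S ≤ Ψ S) :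
    expect n a b Φ ≤ expect n a b Ψ :=
  Finset.sum_le_sum fun S _ => mul_le_mul_of_nonneg_left (h S) (prob_nonneg ha hb S)

theorem expect_nonneg (ha : 0 < a) (hb : 0 < b) {Φ : Tableau n → ℝ} (h : ∀ S, 0 ≤ Φ S) :
    0 ≤ expect n a b Φ :=
  Finset.sum_nonneg fun S _ => mul_nonneg (prob_nonneg ha hb S) (h S)

theorem expect_add (Φ Ψ : Tableau n → ℝ) :
    expect n a b (fun S => Φ S + Ψ S) = expect n a b Φ + expect n a b Ψ := by
  simp only [expect, mul_add, Finset.sum_add_distrib]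

theorem expect_sub (Φ Ψ : Tableau n → ℝ) :
    expect n a b (fun S => Φ S - Ψ S) = expect n a b Φ - expect n a b Ψ := by
  simp only [expect, mul_sub, Finset.sum_sub_distrib]

theorem expect_const_mul (c : ℝ) (Φ : Tableau n → ℝ) :
    expect n a b (fun S => c * Φ S) = c * expect n a b Φ := by
  rw [expect, expect, Finset.mul_sum]
  exact Finset.sum_congr rfl fun S _ => by ring

theorem expect_sum {ι : Type*} (s : Finset ι) (Φ : ι → Tableau n → ℝ) :
    expect n a b (fun S => ∑ i ∈ s, Φ i S) = ∑ i ∈ s, expect n a b (Φ i) := by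
  simp only [expect, Finset.mul_sum]
  exact Finset.sum_comm

theorem abs_expect_le (ha : 0 < a) (hb : 0 < b) (Φ : Tableau n → ℝ) :
    |expect n a b Φ| ≤ expect n a b fun S => |Φ S| := by
  refine (Finset.abs_sum_le_sum_abs _ _).trans (Finset.sum_le_sum fun S _ => ?_)
  rw [abs_mul, abs_of_nonneg (prob_nonneg ha hb S)]

/-! ### Removing the top row under the weighted law -/

/-- This is the binomial theorem for T \ J, which ranges over the subsets of F \ J. -/
theorem sum_powerset_filter_superset {F J : Finset ℕ} (hJ : J ⊆ F) (a : ℝ) :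
    ∑ T ∈ F.powerset, (if J ⊆ T then a ^ (F.card - T.card) else 0) =
      (1 + a) ^ (F.card - J.card) := by
  rw [← Finset.sum_filter, ← Finset.card_sdiff_of_subset hJ, ← Finset.sum_pow_mul_eq_add_pow]
  refine Finset.sum_nbij' (fun T => T \ J) (fun T => T ∪ J) ?_ ?_ ?_ ?_ ?_
  · intro T hT
    simp only [Finset.mem_filter, Finset.mem_powerset] at hT ⊢
    exact Finset.sdiff_subset_sdiff hT.1 le_rfl
  · intro T hT
    simp only [Finset.mem_filter, Finset.mem_powerset] at hT ⊢
    exact ⟨Finset.union_subset (hT.trans Finset.sdiff_subset) hJ, Finset.subset_union_right⟩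
  · intro T hT
    simp only [Finset.mem_filter] at hT
    exact Finset.sdiff_union_of_subset hT.2
  · intro T hT
    rw [Finset.mem_powerset] at hT
    rw [Finset.union_sdiff_right]
    exact Finset.sdiff_eq_self_of_disjoint
      (Finset.disjoint_of_subset_left hT Finset.sdiff_disjoint)
  · intro T hT
    simp only [Finset.mem_filter, Finset.mem_powerset] at hT
    rw [Finset.card_sdiff_of_subset hT.2, Finset.card_sdiff_of_subset hJ, one_pow, one_mul]
    have := Finset.card_le_card hT.1
    have := Finset.card_le_card hT.2
    congr 1
    omega

/-- The boxes `J` of the top row are nonempty. -/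
theorem expect_nonempty (ha : 0 < a) (hb : 0 < b) {J : Finset ℕ} (hJ : J ⊆ Finset.range n)
    (Φ : Tableau n → ℝ) :
    expect (n + 1) a b (fun S => ind (∀ j ∈ J, S.get 0 j ≠ none) * Φ S.tail) =
      ((1 + a) ^ J.card)⁻¹ *
        expect n (a + 1) b (fun S => ind (J ⊆ S.free) * Φ S) := by
  rw [expect_succ, expect, Finset.mul_sum, Finset.sum_div]
  refine Finset.sum_congr rfl fun S _ => ?_
  have hZ : normConst n (a + 1) b ≠ 0 := (normConst_pos (by linarith) hb).ne'
  have h1 : ∑ T ∈ S.free.powerset, a ^ (S.free.card - T.card) *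
      (b * (ind (∀ j ∈ J, (S.cons T Symbol.alpha).get 0 j ≠ none) *
        Φ (S.cons T Symbol.alpha).tail) +
      a * (ind (∀ j ∈ J, (S.cons T Symbol.beta).get 0 j ≠ none) *
        Φ (S.cons T Symbol.beta).tail)) =
      (a + b) * Φ S * ∑ T ∈ S.free.powerset,
        (if J ⊆ T then a ^ (S.free.card - T.card) else 0) := by
    rw [Finset.mul_sum]
    refine Finset.sum_congr rfl fun T hT => ?_
    rw [Finset.mem_powerset] at hT
    have h2 : ∀ e, (∀ j ∈ J, (S.cons T e).get 0 j ≠ none) ↔ J ⊆ T := fun e =>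
      forall₂_congr fun j hj =>
        Tableau.get_cons_zero_ne_none S hT e (Finset.mem_range.1 (hJ hj))
    simp only [h2, Tableau.tail_cons]
    by_cases h : J ⊆ T
    · rw [ind_of h, if_pos h]
      ring
    · rw [ind_of_not h, if_neg h]
      ring
  rw [h1, normConst_succ, prob]
  by_cases h : J ⊆ S.free
  -- The factor (1 + a)^|F| is what the free columns contribute under the parameter a + 1;
  -- prescribing J costs (1 + a)^(-|J|).
  · rw [sum_powerset_filter_superset h, ind_of h, add_comm a 1,
      ← Nat.sub_add_cancel (Finset.card_le_card h)]
    rw [add_comm a 1] at hZ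
    simp only [Nat.add_sub_cancel, pow_add]
    have : 1 + a ≠ 0 := by positivity
    field_simp
  · rw [ind_of_not h, Finset.sum_eq_zero]
    · simp
    · intro T hT
      rw [Finset.mem_powerset] at hT
      exact if_neg fun h' => h (h'.trans hT)

theorem expect_tail (ha : 0 < a) (hb : 0 < b) (Φ : Tableau n → ℝ) :
    expect (n + 1) a b (fun S => Φ S.tail) = expect n (a + 1) b Φ := by
  simpa [ind_of] using expect_nonempty ha hb (Finset.empty_subset _) Φ

theorem expect_one (ha : 0 < a) (hb : 0 < b) : expect n a b (fun _ => 1) = 1 := by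
  induction n generalizing a with
  | zero =>
    have hS : ∀ S S' : Tableau 0, S = S' := fun S S' => Tableau.ext_get fun i j h => by omega
    have : Unique (Tableau 0) := ⟨⟨alphaTableau 0⟩, fun S => hS _ _⟩
    rw [expect, Fintype.sum_unique]
    have : (default : Tableau 0).free = ∅ :=
      Finset.subset_empty.1 (by simpa using (default : Tableau 0).free_subset)
    simp [prob, normConst, this, Tableau.freeRows]
  | succ n ih =>
    have := expect_tail (n := n) ha hb (fun _ => 1)
    rw [this, ih (by linarith)]

/-- Only one top row contributes, so there is no binomial sum and the parameter a stays unchanged. A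
leftmost β leaves |F| - |T₀| + 1 free columns, whence the power of a. -/
theorem expect_topRow (ha : 0 < a) (hb : 0 < b) (T₀ : Finset ℕ) (hT₀ : T₀.card ≤ 1)
    (p : Tableau (n + 1) → Prop)
    (hp : ∀ (S : Tableau n) (T : Finset ℕ), T ⊆ S.free → ∀ e,
      (p (S.cons T e) ↔ T = T₀ ∧ e = Symbol.beta)) (Φ : Tableau n → ℝ) :
    expect (n + 1) a b (fun S => ind (p S) * Φ S.tail) =
      a ^ (1 - T₀.card) / (a + b + n) *
        expect n a b (fun S => ind (T₀ ⊆ S.free) * Φ S) := by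
  rw [expect_succ, expect, Finset.mul_sum, Finset.sum_div]
  refine Finset.sum_congr rfl fun S _ => ?_
  have hZ : normConst n a b ≠ 0 := (normConst_pos ha hb).ne'
  have hs : a + b + n ≠ 0 := by positivity
  have h1 : ∑ T ∈ S.free.powerset, a ^ (S.free.card - T.card) *
      (b * (ind (p (S.cons T Symbol.alpha)) * Φ (S.cons T Symbol.alpha).tail) +
      a * (ind (p (S.cons T Symbol.beta)) * Φ (S.cons T Symbol.beta).tail)) =
      ∑ T ∈ S.free.powerset, (if T = T₀ then a ^ (S.free.card - T.card) * a * Φ S else 0) := by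
    refine Finset.sum_congr rfl fun T hT => ?_
    rw [Finset.mem_powerset] at hT
    simp only [hp S T hT, Tableau.tail_cons]
    by_cases h : T = T₀
    · simp only [h, true_and, if_true, ind]
      simp
      ring
    · simp [h, ind]
  rw [h1, normConst_succ', prob, Finset.sum_ite_eq']
  simp only [Finset.mem_powerset]
  by_cases h : T₀ ⊆ S.free
  · rw [if_pos h, ind_of h]
    have h2 : a ^ (S.free.card - T₀.card) * a = a ^ (1 - T₀.card) * a ^ S.free.card := by
      rw [← pow_succ, ← pow_add]
      have := Finset.card_le_card h
      congr 1
      omega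
    rw [h2]
    field_simp
  · simp [h, ind]

/-- The last box of the top row contains a β. -/
theorem expect_end_beta (ha : 0 < a) (hb : 0 < b) (Φ : Tableau n → ℝ) :
    expect (n + 1) a b
      (fun S => ind (S.get 0 n = some Symbol.beta) * Φ S.tail) =
      a / (a + b + n) * expect n a b Φ := by
  have := expect_topRow ha hb ∅ (by simp) (fun S => S.get 0 n = some Symbol.beta)
    (fun S T hT e => ?_) Φ
  · simpa [ind_of] using this
  · have hn : n ∉ T := fun h => S.not_mem_free_self (hT h)
    rw [Tableau.get_cons_zero S hT, Tableau.topRow_eq_beta]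
    refine and_congr_left fun _ => ⟨fun h => ?_, fun h => by simp [h]⟩
    rw [Finset.eq_empty_iff_forall_notMem]
    intro j hj
    have h1 := Tableau.leftmost_le (Finset.mem_insert_of_mem hj : j ∈ insert n T)
    have := (Tableau.mem_free.1 (hT hj)).1
    omega

/-- The top row contains a β in column `j` and otherwise only the symbol in its last box. -/
theorem expect_isolated (ha : 0 < a) (hb : 0 < b) {j : ℕ} (hj : j < n) (Φ : Tableau n → ℝ) :
    expect (n + 1) a b (fun S => ind (S.get 0 j = some Symbol.beta ∧
      ∀ j' < n, j' ≠ j → S.get 0 j' = none) * Φ S.tail) =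
      1 / (a + b + n) * expect n a b (fun S => ind (j ∈ S.free) * Φ S) := by
  have := expect_topRow ha hb {j} (by simp) (fun S => S.get 0 j = some Symbol.beta ∧
      ∀ j' < n, j' ≠ j → S.get 0 j' = none) (fun S T hT e => ?_) Φ
  · simpa [ind_of] using this
  · have hn : n ∉ T := fun h => S.not_mem_free_self (hT h)
    rw [Tableau.get_cons_zero S hT, Tableau.topRow_eq_beta]
    constructor
    · rintro ⟨⟨h1, h2⟩, h3⟩
      refine ⟨?_, h2⟩
      have hjT : j ∈ T := by
        have := Tableau.leftmost_mem n T
        rw [← h1, Finset.mem_insert] at this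
        exact this.resolve_left (by omega)
      refine Finset.eq_singleton_iff_unique_mem.2 ⟨hjT, fun j' hj' => ?_⟩
      by_contra hne
      have h4 := (Tableau.mem_free.1 (hT hj')).1
      exact (Tableau.get_cons_zero_ne_none S hT e h4).2 hj' (h3 j' h4 hne)
    · rintro ⟨rfl, rfl⟩
      refine ⟨⟨(Tableau.leftmost_singleton hj).symm, rfl⟩, fun j' hj' hne => ?_⟩
      by_contra h
      exact hne (by simpa using (Tableau.get_cons_zero_ne_none S hT _ hj').1 h)

theorem partitionFunction_eq {α β : ℝ} (hα : 0 < α) (hβ : 0 < β) :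
    partitionFunction n α β = (α * β) ^ n * normConst n α⁻¹ β⁻¹ := by
  have h := expect_one (n := n) (inv_pos.2 hα) (inv_pos.2 hβ)
  have hZ := normConst_pos (n := n) (inv_pos.2 hα) (inv_pos.2 hβ)
  simp only [expect, prob, mul_one] at h
  rw [← Finset.sum_div, div_eq_one_iff_eq hZ.ne'] at h
  rw [← h, partitionFunction, Finset.mul_sum]
  exact Finset.sum_congr rfl fun S _ => S.weight_eq hα hβ

theorem tableauProb_eq {α β : ℝ} (hα : 0 < α) (hβ : 0 < β) (S : Tableau n) :
    tableauProb n α β S = prob α⁻¹ β⁻¹ S := by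
  rw [tableauProb, partitionFunction_eq hα hβ, S.weight_eq hα hβ, prob,
    mul_div_mul_left _ _ (by positivity)]

/-! ### Removing several rows and counting β's on a diagonal -/

namespace Tableau

variable {n : ℕ}

/-- Removal of the `d` top rows. -/
def drop : (d : ℕ) → Tableau (n + d) → Tableau n
  | 0, S => S
  | d + 1, S => drop d (tail (n := n + d) S)

open Classical in
-- Each row meets the diagonal in at most one box. The condition `i + k ≤ n` guards the truncated
-- column index.
theorem betaCount_eq_sum (k : ℕ) (S : Tableau n) :
    betaCount k S = ∑ i ∈ Finset.range n,
      if i + k ≤ n ∧ S.get i (n - i - k) = some Symbol.beta then 1 else 0 := by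
  rw [← Finset.card_filter, betaCount]
  refine Finset.card_bij (fun x _ => x.row - 1) ?_ ?_ ?_
  · intro x hx
    have hb := box_bounds x
    simp only [Finset.mem_filter, Finset.mem_univ, true_and, Box.OnDiagonal, S.fill_eq_get] at hx
    simp only [Finset.mem_filter, Finset.mem_range]
    refine ⟨by omega, by omega, ?_⟩
    rw [← hx.2]
    congr 1
    omega
  · intro x hx y hy hxy
    have hb := box_bounds x
    have hb' := box_bounds y
    have hx' : x.row + x.col + k = n + 2 := (Finset.mem_filter.1 hx).2.1
    have hy' : y.row + y.col + k = n + 2 := (Finset.mem_filter.1 hy).2.1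
    change x.row - 1 = y.row - 1 at hxy
    refine Subtype.ext (Prod.ext ?_ ?_)
    · change x.row = y.row
      omega
    · change x.col = y.col
      omega
  · intro i hi
    simp only [Finset.mem_filter, Finset.mem_range] at hi
    have hlt := S.lt_of_get (i := i) (j := n - i - k) (by simp [hi.2.2])
    refine ⟨⟨(i + 1, n - i - k + 1), ?_⟩, ?_, ?_⟩
    · simp only [Finset.mem_filter, Finset.mem_product, Finset.mem_Icc]
      omega
    · simp only [Finset.mem_filter, Finset.mem_univ, true_and, Box.OnDiagonal, S.fill_eq_get,
        Box.row, Box.col, Nat.add_sub_cancel]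
      exact ⟨by omega, hi.2.2⟩
    · simp [Box.row]

open Classical in
theorem betaCount_succ (k : ℕ) (S : Tableau (n + 1)) :
    betaCount k S = betaCount k S.tail +
      if k ≤ n + 1 ∧ S.get 0 (n + 1 - k) = some Symbol.beta then 1 else 0 := by
  rw [betaCount_eq_sum, betaCount_eq_sum, Finset.sum_range_succ']
  congr 1
  · refine Finset.sum_congr rfl fun i _ => if_congr ?_ rfl rfl
    rw [get_tail, show n + 1 - (i + 1) - k = n - i - k by omega]
    exact and_congr_left fun _ => by omega
  · simp

theorem betaCount_of_lt {k : ℕ} (h : n < k) (S : Tableau n) : betaCount k S = 0 := by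
  rw [betaCount_eq_sum]
  exact Finset.sum_eq_zero fun i _ => if_neg fun h' => by omega

theorem betaCount_drop (k d : ℕ) (S : Tableau (n + d))
    (h : ∀ i < d, i + k ≤ n + d → S.get i (n + d - i - k) ≠ some Symbol.beta) :
    betaCount k S = betaCount k (drop d S) := by
  induction d with
  | zero => rfl
  | succ d ih =>
    rw [drop, ← ih, betaCount_succ (n := n + d), if_neg, add_zero]
    · rintro ⟨h1, h2⟩
      exact h 0 (by omega) (by omega) h2
    · intro i hi hik
      rw [get_tail, show n + d - i - k = n + (d + 1) - (i + 1) - k by omega]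
      exact h (i + 1) (by omega) (by omega)

theorem get_drop (d : ℕ) (S : Tableau (n + d)) (i j : ℕ) :
    (drop d S).get i j = S.get (i + d) j := by
  induction d with
  | zero => rfl
  | succ d ih =>
    rw [drop, ih, get_tail]
    rfl

theorem mem_free_tail {S : Tableau (n + 1)} {j : ℕ} (hj : j < n) (h : j ∈ S.free) :
    j ∈ S.tail.free :=
  mem_free.2 ⟨hj, fun i => by rw [get_tail]; exact (mem_free.1 h).2 _⟩

theorem get_eq_beta_of_free {S : Tableau n} {i j : ℕ} (h : j ∈ S.free) (hij : i + j + 1 = n) :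
    S.get i j = some Symbol.beta := by
  rcases hg : S.get i j with _ | _ | _
  · exact absurd hg (S.get_diagonal hij)
  · exact absurd hg ((mem_free.1 h).2 i)
  · rfl

/-- Column `j` contains a β in its lowest box, which is in row `d`, and no other symbol. -/
def OnlyBeta (S : Tableau n) (d j : ℕ) : Prop :=
  (∀ i < d, S.get i j = none) ∧ S.get d j = some Symbol.beta

theorem OnlyBeta.mem_free {S : Tableau n} {d j : ℕ} (h : S.OnlyBeta d j) (hn : n ≤ d + j + 1) :
    j ∈ S.free := by
  have := S.lt_of_get (i := d) (j := j) (by simp [h.2])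
  refine Tableau.mem_free.2 ⟨by omega, fun i => ?_⟩
  rcases lt_trichotomy i d with hi | rfl | hi
  · simp [h.1 i hi]
  · simp [h.2]
  · simp [S.get_of_le (i := i) (j := j) (by omega)]

end Tableau

open Tableau

variable {n : ℕ} {a b : ℝ}

/-- By induction over the rows above the β. The event that the top box is empty is the event for the
tail minus its part with a nonempty top box; as column j is free, that part carries the factor 1/(1
+ a). The remaining factor a/(1 + a) turns the numerator a + 1 into a, while a + b + size is
preserved. -/
theorem expect_onlyBeta (ha : 0 < a) (hb : 0 < b) (j d : ℕ) (Φ : Tableau j → ℝ) :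
    expect (j + 1 + d) a b (fun S => ind (S.OnlyBeta d j) * Φ (drop d S).tail) =
      a / (a + b + j + d) * expect j (a + d) b Φ := by
  induction d generalizing a with
  | zero =>
    have := expect_end_beta ha hb Φ
    simp only [Nat.cast_zero, add_zero]
    rw [← this]
    exact expect_congr fun S => by simp [OnlyBeta, drop]
  | succ d ih =>
    have ha' : 0 < a + 1 := by linarith
    have h1 := expect_tail ha hb (n := j + 1 + d)
      (fun S => ind (S.OnlyBeta d j) * Φ (drop d S).tail)
    have h2 := expect_nonempty ha hb (n := j + 1 + d) (J := {j})
      (by simp; omega) (fun S => ind (S.OnlyBeta d j) * Φ (drop d S).tail)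
    have h3 : ∀ S : Tableau (j + 1 + d), ind ({j} ⊆ S.free) *
        (ind (S.OnlyBeta d j) * Φ (drop d S).tail) = ind (S.OnlyBeta d j) * Φ (drop d S).tail := by
      intro S
      by_cases h : S.OnlyBeta d j
      · rw [ind_of (p := {j} ⊆ S.free) (by simpa using h.mem_free (by omega)), one_mul]
      · rw [ind_of_not h, zero_mul, mul_zero]
    rw [expect_congr h3] at h2
    have h4 : ∀ S : Tableau (j + 1 + d + 1),
        ind (S.OnlyBeta (d + 1) j) * Φ (drop (n := j + 1) (d + 1) S).tail =
        ind (S.tail.OnlyBeta d j) * Φ (drop d S.tail).tail -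
          ind (∀ j' ∈ ({j} : Finset ℕ), S.get 0 j' ≠ none) *
            (ind (S.tail.OnlyBeta d j) * Φ (drop d S.tail).tail) := by
      intro S
      have h5 : S.OnlyBeta (d + 1) j ↔ S.get 0 j = none ∧ S.tail.OnlyBeta d j := by
        simp only [OnlyBeta, get_tail]
        constructor
        · rintro ⟨h6, h7⟩
          exact ⟨h6 0 (by omega), fun i hi => h6 _ (by omega), h7⟩
        · rintro ⟨h6, h7, h8⟩
          refine ⟨fun i hi => ?_, h8⟩
          cases i with
          | zero => exact h6
          | succ i => exact h7 i (by omega)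
      rw [drop]
      by_cases h6 : S.get 0 j = none <;> by_cases h7 : S.tail.OnlyBeta d j <;>
        simp [ind, h5, h6, h7]
    refine (expect_congr (n := j + 1 + d + 1) h4).trans ?_
    rw [expect_sub, h1, h2, ih ha', Finset.card_singleton, pow_one]
    rw [show a + 1 + (d : ℝ) = a + ((d + 1 : ℕ) : ℝ) by push_cast; ring]
    have h8 : a + 1 + b + j + d ≠ 0 := by positivity
    have h9 : a + b + j + ((d + 1 : ℕ) : ℝ) ≠ 0 := by positivity
    have h10 : 1 + a ≠ 0 := by positivity
    have h11 : (a + 1) / (a + 1 + b + j + d) - (1 + a)⁻¹ * ((a + 1) / (a + 1 + b + j + d)) =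
        a / (a + b + j + ((d + 1 : ℕ) : ℝ)) := by
      push_cast at h9 ⊢
      field_simp
      ring
    rw [← h11]
    ring

/-! ### Bounds for the probabilities of some events -/

/-- A free column stays free when rows above are removed. After d removals its lowest box is the
last one of the top row, and it must hold a β; the parameter is then a + d. -/
theorem expect_free_le (ha : 0 < a) (hb : 0 < b) (j d : ℕ) :
    expect (j + 1 + d) a b (fun S => ind (j ∈ S.free)) ≤ (a + d) / (a + b + j + d) := by
  induction d generalizing a with
  | zero =>
    have := expect_end_beta ha hb (n := j) (fun _ => 1)
    rw [expect_one ha hb] at this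
    simp only [Nat.cast_zero, add_zero]
    rw [mul_one] at this
    rw [← this]
    refine expect_mono ha hb fun S => ?_
    rw [mul_one]
    exact ind_mono fun h => get_eq_beta_of_free h (by omega)
  | succ d ih =>
    have ha' : 0 < a + 1 := by linarith
    have h := expect_mono (n := j + 1 + d + 1) ha hb (Φ := fun S => ind (j ∈ S.free))
      (Ψ := fun S => ind (j ∈ S.tail.free))
      (fun S => ind_mono fun h => mem_free_tail (by omega) h)
    rw [expect_tail ha hb (fun S => ind (j ∈ S.free))] at h
    refine (h.trans (ih ha')).trans (le_of_eq ?_)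
    push_cast
    ring_nf

theorem expect_free_and_free_le (ha : 0 < a) (hb : 0 < b) (j e d : ℕ) :
    expect (j + 1 + e + 1 + d) a b (fun S => ind (j ∈ S.free ∧ j + 1 + e ∈ S.free)) ≤
      (a + d) * (a + d + e) / ((a + b + j + 1 + e + d) * (a + b + j + e + d)) := by
  induction d generalizing a with
  | zero =>
    have h := expect_end_beta ha hb (n := j + 1 + e) (fun S => ind (j ∈ S.free))
    have h' := expect_free_le ha hb j e
    simp only [Nat.cast_zero, add_zero]
    calc _ ≤ _ := expect_mono ha hb (Ψ := fun S => ind (S.get 0 (j + 1 + e) = some Symbol.beta) *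
          ind (j ∈ S.tail.free)) fun S => by
            rw [ind_mul]
            exact ind_mono fun h =>
              ⟨get_eq_beta_of_free h.2 (by omega), mem_free_tail (by omega) h.1⟩
      _ ≤ a / (a + b + (j + 1 + e : ℕ)) * ((a + e) / (a + b + j + e)) := by
            rw [h]
            exact mul_le_mul_of_nonneg_left h' (by positivity)
      _ = _ := by
            rw [div_mul_div_comm]
            push_cast
            ring_nf
  | succ d ih =>
    have ha' : 0 < a + 1 := by linarith
    have h := expect_mono (n := j + 1 + e + 1 + d + 1) ha hb
      (Φ := fun S => ind (j ∈ S.free ∧ j + 1 + e ∈ S.free))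
      (Ψ := fun S => ind (j ∈ S.tail.free ∧ j + 1 + e ∈ S.tail.free))
      (fun S => ind_mono fun h => ⟨mem_free_tail (by omega) h.1, mem_free_tail (by omega) h.2⟩)
    rw [expect_tail ha hb (fun S => ind (j ∈ S.free ∧ j + 1 + e ∈ S.free))] at h
    refine (h.trans (ih ha')).trans (le_of_eq ?_)
    push_cast
    ring_nf

theorem expect_top_nonempty (ha : 0 < a) (hb : 0 < b) {l : ℕ} (hl : l < n)
    (p : Tableau n → Prop) :
    expect (n + 1) a b (fun S => ind (S.get 0 l ≠ none ∧ p S.tail)) =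
      (1 + a)⁻¹ * expect n (a + 1) b (fun S => ind (l ∈ S.free ∧ p S)) := by
  have := expect_nonempty ha hb (n := n) (J := {l}) (by simpa using hl) (fun S => ind (p S))
  simpa [ind_mul] using this

/-- Removing the i top rows brings the box into the top row, where being nonempty costs 1/(1 + a +
i), and forces column l to be free below. The bound keeps only 1/(1 + a). -/
theorem expect_free_and_nonempty_le (ha : 0 < a) (hb : 0 < b) {j l m : ℕ} (hj : j < m)
    (hl : l < m) (i : ℕ) :
    expect (m + 1 + i) a b (fun S => ind (j ∈ S.free ∧ S.get i l ≠ none)) ≤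
      (1 + a)⁻¹ * expect m (a + 1 + i) b (fun S => ind (l ∈ S.free ∧ j ∈ S.free)) := by
  induction i generalizing a with
  | zero =>
    have h := expect_top_nonempty ha hb hl (fun S => j ∈ S.free)
    simp only [Nat.cast_zero, add_zero]
    rw [← h]
    exact expect_mono ha hb fun S => ind_mono fun h => ⟨h.2, mem_free_tail hj h.1⟩
  | succ i ih =>
    have ha' : 0 < a + 1 := by linarith
    have h := expect_mono (n := m + 1 + i + 1) ha hb
      (Φ := fun S => ind (j ∈ S.free ∧ S.get (i + 1) l ≠ none))
      (Ψ := fun S => ind (j ∈ S.tail.free ∧ S.tail.get i l ≠ none))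
      (fun S => ind_mono fun h => ⟨mem_free_tail (by omega) h.1, by simpa using h.2⟩)
    rw [expect_tail ha hb (fun S => ind (j ∈ S.free ∧ S.get i l ≠ none))] at h
    refine (h.trans (ih ha')).trans ?_
    rw [show a + 1 + ((i + 1 : ℕ) : ℝ) = a + 1 + 1 + i by push_cast; ring]
    refine mul_le_mul_of_nonneg_right ?_ (expect_nonneg (by positivity) hb fun S => ind_nonneg _)
    exact inv_anti₀ (by positivity) (by linarith)

theorem ind_exists_le (p : ℕ → Prop) (κ : ℕ) :
    ind (∃ i < κ, p i) ≤ ∑ i ∈ Finset.range κ, ind (p i) := by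
  by_cases h : ∃ i < κ, p i
  · obtain ⟨i, hi, hp⟩ := h
    rw [ind_of ⟨i, hi, hp⟩, ← ind_of hp]
    exact Finset.single_le_sum (f := fun i => ind (p i)) (fun i _ => ind_nonneg _)
      (Finset.mem_range.2 hi)
  · rw [ind_of_not h]
    exact Finset.sum_nonneg fun i _ => ind_nonneg _

theorem expect_exists_le (ha : 0 < a) (hb : 0 < b) (p : ℕ → Tableau n → Prop) (κ : ℕ) {c : ℝ}
    (h : ∀ i < κ, expect n a b (fun S => ind (p i S)) ≤ c) :
    expect n a b (fun S => ind (∃ i < κ, p i S)) ≤ κ * c := by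
  calc _ ≤ _ := expect_mono ha hb fun S => ind_exists_le (fun i => p i S) κ
    _ = ∑ i ∈ Finset.range κ, expect n a b (fun S => ind (p i S)) := expect_sum _ _
    _ ≤ ∑ i ∈ Finset.range κ, c := Finset.sum_le_sum fun i hi => h i (Finset.mem_range.1 hi)
    _ = κ * c := by simp

/-- Column `j` is nonempty in the top row, and one more box near it is nonempty that is empty for
most tableaux. -/
def Crowded (κ j : ℕ) (S : Tableau (j + 1 + κ + 1)) : Prop :=
  (∃ e < κ, S.get 0 j ≠ none ∧ S.get 0 (j + 1 + e) ≠ none) ∨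
  (∃ i < κ, S.get 0 j ≠ none ∧ S.get (i + 1) j ≠ none) ∨
  (∃ i < κ, i + 1 ≤ j ∧ S.get 0 j ≠ none ∧ S.get (i + 1) (j - 1 - i) ≠ none)

/-- A union bound over 3κ events. A nonempty box costs about 1/a and a free column about a/s. Two
boxes in distinct columns thus give order 1/s², and two boxes in column j give order 1/((1 + a)s),
which dominates. -/
theorem expect_crowded_le (ha : 0 < a) (hb : 0 < b) (κ j : ℕ) :
    expect (j + 1 + κ + 1) a b (fun S => ind (Crowded κ j S)) ≤
      κ * (3 * (1 + 2 * κ) ^ 2) / ((1 + a) * (a + b + j + κ)) := by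
  have hκ : (0 : ℝ) ≤ κ := Nat.cast_nonneg κ
  have hj : (0 : ℝ) ≤ j := Nat.cast_nonneg j
  have ha' : 0 < a + 1 := by linarith
  have hl : 0 < a + b + j + κ := by positivity
  have hl' : 0 < a + b + j + κ + 1 := by positivity
  set c : ℝ := (1 + 2 * κ) ^ 2 / ((1 + a) * (a + b + j + κ)) with hc
  -- The numerators of both two-column events are at most ((1 + 2κ)(1 + a))², which cancels the two
  -- factors 1/(1 + a).
  have hpair : ∀ x y : ℝ, 0 ≤ x → 0 ≤ y → x ≤ a + 1 + 2 * κ → y ≤ a + 1 + 2 * κ →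
      (1 + a)⁻¹ * ((1 + a)⁻¹ * (x * y / ((a + b + j + κ + 1) * (a + b + j + κ)))) ≤ c := by
    intro x y hx hy hx' hy'
    have h1 : a + 1 + 2 * κ ≤ (1 + 2 * κ) * (1 + a) := by nlinarith
    have h2 : x * y ≤ ((1 + 2 * κ) * (1 + a)) * ((1 + 2 * κ) * (1 + a)) :=
      mul_le_mul (hx'.trans h1) (hy'.trans h1) hy (by positivity)
    have h3 : 1 + a ≤ a + b + j + κ + 1 := by linarith
    calc _ = x * y / ((1 + a) * (1 + a) * ((a + b + j + κ + 1) * (a + b + j + κ))) := by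
            field_simp
      _ ≤ ((1 + 2 * κ) * (1 + a)) * ((1 + 2 * κ) * (1 + a)) /
            ((1 + a) * (1 + a) * ((1 + a) * (a + b + j + κ))) := by gcongr
      _ = c := by rw [hc]; field_simp
  have h1 : ∀ e < κ, expect (j + 1 + κ + 1) a b
      (fun S => ind (S.get 0 j ≠ none ∧ S.get 0 (j + 1 + e) ≠ none)) ≤ c := by
    intro e he
    obtain ⟨d, rfl⟩ := Nat.exists_eq_add_of_lt he
    have h := expect_nonempty ha hb (n := j + 1 + (e + d + 1)) (J := {j, j + 1 + e})
      (by
        intro x hx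
        simp only [Finset.mem_insert, Finset.mem_singleton] at hx
        rw [Finset.mem_range]
        omega) (fun _ => 1)
    rw [Finset.card_pair (by omega)] at h
    have h' := expect_free_and_free_le ha' hb j e d
    rw [show j + 1 + e + 1 + d = j + 1 + (e + d + 1) by ring] at h'
    refine le_trans (le_trans (le_of_eq ?_) (mul_le_mul_of_nonneg_left h'
      (by positivity : 0 ≤ ((1 + a) ^ 2)⁻¹))) ((le_of_eq ?_).trans
        (hpair (a + 1 + d) (a + 1 + d + e) (by positivity) (by positivity)
        (by push_cast; linarith) (by push_cast; linarith)))
    · simpa [Finset.insert_subset_iff] using h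
    · push_cast
      rw [← mul_assoc, ← mul_inv, ← pow_two]
      ring_nf
  have hinv : (1 + (a + 1))⁻¹ ≤ (1 + a)⁻¹ := inv_anti₀ (by positivity) (by linarith)
  have hinv0 : 0 ≤ (1 + a)⁻¹ := by positivity
  have h2 : ∀ i < κ, expect (j + 1 + κ + 1) a b
      (fun S => ind (S.get 0 j ≠ none ∧ S.get (i + 1) j ≠ none)) ≤ c := by
    intro i hi
    obtain ⟨t, ht⟩ := Nat.exists_eq_add_of_lt hi
    have htr : (κ : ℝ) = i + t + 1 := by rw [ht]; push_cast; ring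
    have h := expect_top_nonempty ha hb (n := j + 1 + κ) (l := j) (by omega)
      (fun S => S.get i j ≠ none)
    have h' := expect_free_and_nonempty_le ha' hb (j := j) (l := j) (m := j + 1 + t)
      (by omega) (by omega) i
    have h'' := expect_free_le (a := a + 1 + 1 + i) (by positivity) hb j t
    rw [show j + 1 + t + 1 + i = j + 1 + κ by omega] at h'
    simp only [get_tail] at h
    simp only [and_self] at h'
    rw [h]
    calc (1 + a)⁻¹ * _ ≤ (1 + a)⁻¹ * ((1 + a)⁻¹ *
          ((a + 1 + 1 + i + t) / (a + 1 + 1 + i + b + j + t))) :=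
            mul_le_mul_of_nonneg_left (h'.trans (mul_le_mul hinv h''
              (expect_nonneg (by positivity) hb fun S => ind_nonneg _) hinv0)) hinv0
      _ = (1 + a)⁻¹ * ((1 + a)⁻¹ * ((a + 1 + κ) / (a + b + j + κ + 1))) := by
            rw [htr]
            ring_nf
      _ ≤ (1 + a)⁻¹ * ((1 + a)⁻¹ * (((1 + 2 * κ) * (1 + a)) / (a + b + j + κ))) := by
            refine mul_le_mul_of_nonneg_left (mul_le_mul_of_nonneg_left ?_ hinv0) hinv0
            exact div_le_div₀ (by positivity) (by nlinarith) hl (by linarith)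
      _ = (1 + 2 * κ) * 1 / ((1 + a) * (a + b + j + κ)) := by field_simp
      _ ≤ c := by
            rw [hc, pow_two]
            gcongr
            linarith
  have h3 : ∀ i < κ, expect (j + 1 + κ + 1) a b
      (fun S => ind (i + 1 ≤ j ∧ S.get 0 j ≠ none ∧ S.get (i + 1) (j - 1 - i) ≠ none)) ≤ c := by
    intro i hi
    by_cases hij : i + 1 ≤ j
    swap
    · simp only [hij, false_and]
      rw [ind_of_not not_false]
      simp only [expect, mul_zero, Finset.sum_const_zero]
      positivity
    obtain ⟨t, ht⟩ := Nat.exists_eq_add_of_lt hi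
    have htr : (κ : ℝ) = i + t + 1 := by rw [ht]; push_cast; ring
    obtain ⟨l, hl⟩ := Nat.exists_eq_add_of_le hij
    have hlr : (j : ℝ) = i + 1 + l := by rw [hl]; push_cast; ring
    have hjl : j - 1 - i = l := by omega
    simp only [hij, true_and, hjl]
    have h := expect_top_nonempty ha hb (n := j + 1 + κ) (l := j) (by omega)
      (fun S => S.get i l ≠ none)
    have h' := expect_free_and_nonempty_le ha' hb (j := j) (l := l) (m := j + 1 + t)
      (by omega) (by omega) i
    have h'' := expect_free_and_free_le (a := a + 1 + 1 + i) (by positivity) hb l i t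
    rw [show j + 1 + t + 1 + i = j + 1 + κ by omega] at h'
    rw [show l + 1 + i + 1 + t = j + 1 + t by omega] at h''
    simp only [show l + 1 + i = j by omega] at h''
    simp only [get_tail] at h
    rw [h]
    calc (1 + a)⁻¹ * _ ≤ (1 + a)⁻¹ * ((1 + a)⁻¹ *
          ((a + 1 + 1 + i + t) * (a + 1 + 1 + i + t + i) /
          ((a + 1 + 1 + i + b + l + 1 + i + t) * (a + 1 + 1 + i + b + l + i + t)))) :=
            mul_le_mul_of_nonneg_left (h'.trans (mul_le_mul hinv h''
              (expect_nonneg (by positivity) hb fun S => ind_nonneg _) hinv0)) hinv0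
      _ = (1 + a)⁻¹ * ((1 + a)⁻¹ * ((a + 1 + κ) * (a + 1 + κ + i) /
            ((a + b + j + κ + 1) * (a + b + j + κ)))) := by
            rw [htr, hlr]
            ring_nf
      _ ≤ c := hpair _ _ (by positivity) (by positivity) (by linarith) (by linarith)
  calc expect (j + 1 + κ + 1) a b (fun S => ind (Crowded κ j S))
      ≤ expect (j + 1 + κ + 1) a b (fun S =>
          ind (∃ e < κ, S.get 0 j ≠ none ∧ S.get 0 (j + 1 + e) ≠ none) +
          (ind (∃ i < κ, S.get 0 j ≠ none ∧ S.get (i + 1) j ≠ none) +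
          ind (∃ i < κ, i + 1 ≤ j ∧ S.get 0 j ≠ none ∧ S.get (i + 1) (j - 1 - i) ≠ none))) := by
        refine expect_mono ha hb fun S => ?_
        by_cases h : Crowded κ j S
        · rw [ind_of h]
          rcases h with h | h | h
          · rw [ind_of h]
            linarith [ind_nonneg (∃ i < κ, S.get 0 j ≠ none ∧ S.get (i + 1) j ≠ none),
              ind_nonneg (∃ i < κ, i + 1 ≤ j ∧ S.get 0 j ≠ none ∧ S.get (i + 1) (j - 1 - i) ≠ none)]
          · rw [ind_of h]
            linarith [ind_nonneg (∃ e < κ, S.get 0 j ≠ none ∧ S.get 0 (j + 1 + e) ≠ none),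
              ind_nonneg (∃ i < κ, i + 1 ≤ j ∧ S.get 0 j ≠ none ∧ S.get (i + 1) (j - 1 - i) ≠ none)]
          · rw [ind_of h]
            linarith [ind_nonneg (∃ e < κ, S.get 0 j ≠ none ∧ S.get 0 (j + 1 + e) ≠ none),
              ind_nonneg (∃ i < κ, S.get 0 j ≠ none ∧ S.get (i + 1) j ≠ none)]
        · rw [ind_of_not h]
          exact add_nonneg (ind_nonneg _) (add_nonneg (ind_nonneg _) (ind_nonneg _))
    _ ≤ κ * c + (κ * c + κ * c) := by
        rw [expect_add, expect_add]
        exact add_le_add (expect_exists_le ha hb _ _ h1)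
          (add_le_add (expect_exists_le ha hb _ _ h2) (expect_exists_le ha hb _ _ h3))
    _ = _ := by
        rw [hc]
        ring

/-- Replacing `g` of the number of β's by its value after the removal of the rows that contain the
β in column `j` of the top row costs at most the probability of crowded tableaux. -/
theorem abs_expect_top_beta_sub_le (ha : 0 < a) (hb : 0 < b) (κ j : ℕ) {g : ℕ → ℝ}
    (hg : ∀ m, |g m| ≤ 1) :
    |expect (j + 1 + κ + 1) a b
        (fun S => ind (S.get 0 j = some Symbol.beta) * g (betaCount (κ + 2) S.tail)) -
      a / ((a + b + j + κ + 1) * (a + b + j + κ)) *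
        expect j (a + κ) b (fun S => g (betaCount (κ + 2) S))| ≤
      2 * (κ * (3 * (1 + 2 * κ) ^ 2)) / ((1 + a) * (a + b + j + κ)) := by
  have h1 := expect_isolated ha hb (n := j + 1 + κ) (j := j) (by omega)
    (fun S => ind (S.OnlyBeta κ j) * g (betaCount (κ + 2) (drop κ S).tail))
  have h2 : ∀ S : Tableau (j + 1 + κ), ind (j ∈ S.free) *
      (ind (S.OnlyBeta κ j) * g (betaCount (κ + 2) (drop κ S).tail)) =
      ind (S.OnlyBeta κ j) * g (betaCount (κ + 2) (drop κ S).tail) := by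
    intro S
    by_cases h : S.OnlyBeta κ j
    · rw [ind_of (h.mem_free (by omega)), one_mul]
    · rw [ind_of_not h, zero_mul, mul_zero]
  rw [expect_congr h2, expect_onlyBeta ha hb j κ (fun S => g (betaCount (κ + 2) S)),
    ← mul_assoc, div_mul_div_comm, one_mul] at h1
  rw [show (a + b + ((j + 1 + κ : ℕ) : ℝ)) = a + b + j + κ + 1 by push_cast; ring] at h1
  rw [← h1, ← expect_sub]
  refine (abs_expect_le ha hb _).trans ?_
  have h3 := expect_crowded_le ha hb κ j
  rw [mul_div_assoc]
  refine le_trans ?_ (mul_le_mul_of_nonneg_left h3 (by norm_num : (0 : ℝ) ≤ 2))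
  rw [← expect_const_mul]
  refine expect_mono ha hb fun S => ?_
  have hg' := fun m => abs_le.1 (hg m)
  by_cases hB : S.get 0 j = some Symbol.beta
  swap
  · rw [ind_of_not hB, ind_of_not fun h => hB h.1]
    simp only [zero_mul, sub_zero, abs_zero]
    exact mul_nonneg (by norm_num) (ind_nonneg _)
  rw [ind_of hB, one_mul, ← mul_assoc, ind_mul]
  -- On crowded tableaux the difference is at most 2; on all others the two integrands agree.
  by_cases hC : Crowded κ j S
  · rw [ind_of hC, abs_le]
    have := hg' (betaCount (κ + 2) S.tail)
    have := hg' (betaCount (κ + 2) (drop κ S.tail).tail)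
    rcases em (_ ∧ S.tail.OnlyBeta κ j) with h | h
    · rw [ind_of h]
      constructor <;> linarith
    · rw [ind_of_not h]
      constructor <;> linarith
  · have hne : S.get 0 j ≠ none := by simp [hB]
    simp only [Crowded, not_or, not_exists, not_and, not_not] at hC
    obtain ⟨hC1, hC2, hC3⟩ := hC
    -- The foot of column j lies on the outer diagonal, hence is filled; an α there would empty the
    -- top box.
    have hO : S.tail.OnlyBeta κ j := by
      refine ⟨fun i hi => by simpa using hC2 i hi hne, ?_⟩
      rw [get_tail]
      rcases hg : S.get (κ + 1) j with _ | _ | _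
      · exact absurd hg (S.get_diagonal (by omega))
      · exact absurd (S.get_north hg (by omega)) hne
      · rfl
    have hiso : ∀ j' < j + 1 + κ, j' ≠ j → S.get 0 j' = none := by
      intro j' hj' hne'
      rcases lt_or_gt_of_ne hne' with h | h
      · exact S.get_west hB h
      · have := hC1 (j' - (j + 1)) (by omega) hne
        rwa [show j + 1 + (j' - (j + 1)) = j' by omega] at this
    -- The κ rows below the top one have an empty box on the diagonal, and in the foot row the β of
    -- column j empties all boxes to its west.
    have hdrop : betaCount (κ + 2) S.tail = betaCount (κ + 2) (drop κ S.tail).tail := by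
      rw [betaCount_drop (n := j + 1) (κ + 2) κ S.tail, betaCount_succ, if_neg, add_zero]
      · rintro ⟨h4, h5⟩
        rw [get_drop, zero_add, S.tail.get_west hO.2 (by omega)] at h5
        simp at h5
      · intro i hi hle
        rw [get_tail, show j + 1 + κ - i - (κ + 2) = j - 1 - i by omega,
          hC3 i hi (by omega) hne]
        simp
    rw [ind_of ⟨⟨hB, hiso⟩, hO⟩, hdrop]
    simp only [one_mul, sub_self, abs_zero]
    exact mul_nonneg (by norm_num) (ind_nonneg _)

/-- The probability of `m` β's on the diagonal with number `κ + 2`. -/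
noncomputable def betaProb (κ : ℕ) (b : ℝ) (m n : ℕ) (a : ℝ) : ℝ :=
  expect n a b fun S => ind (betaCount (κ + 2) S = m)

theorem betaProb_nonneg (ha : 0 < a) (hb : 0 < b) (κ m n : ℕ) : 0 ≤ betaProb κ b m n a :=
  expect_nonneg ha hb fun _ => ind_nonneg _

theorem betaProb_le_one (ha : 0 < a) (hb : 0 < b) (κ m n : ℕ) : betaProb κ b m n a ≤ 1 := by
  rw [← expect_one (n := n) ha hb]
  exact expect_mono ha hb fun _ => ind_le_one _

theorem betaProb_of_lt (ha : 0 < a) (hb : 0 < b) {κ n : ℕ} (h : n < κ + 2) (m : ℕ) :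
    betaProb κ b m n a = if m = 0 then 1 else 0 := by
  simp only [betaProb, betaCount_of_lt h]
  split_ifs with hm
  · rw [ind_of hm.symm]
    exact expect_one ha hb
  · rw [ind_of_not fun h' => hm h'.symm]
    simp [expect]

/-- A β in the diagonal box of the top row raises the count by one, so the increment is the
expectation of g(N) = [N + 1 = m] - [N = m] on that event, and |g| ≤ 1. -/
theorem abs_betaProb_succ_sub_le (ha : 0 < a) (hb : 0 < b) (κ j m : ℕ) :
    |betaProb κ b m (j + 1 + κ + 1) a - betaProb κ b m (j + 1 + κ) (a + 1) -
      a / ((a + b + j + κ + 1) * (a + b + j + κ)) *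
        ((if m = 0 then 0 else betaProb κ b (m - 1) j (a + κ)) - betaProb κ b m j (a + κ))| ≤
      2 * (κ * (3 * (1 + 2 * κ) ^ 2)) / ((1 + a) * (a + b + j + κ)) := by
  have h1 := abs_expect_top_beta_sub_le ha hb κ j
    (g := fun N => ind (N + 1 = m) - ind (N = m)) (fun N => by
      have := ind_nonneg (N + 1 = m)
      have := ind_nonneg (N = m)
      have := ind_le_one (N + 1 = m)
      have := ind_le_one (N = m)
      rw [abs_le]
      constructor <;> linarith)
  have h2 : betaProb κ b m (j + 1 + κ + 1) a - betaProb κ b m (j + 1 + κ) (a + 1) =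
      expect (j + 1 + κ + 1) a b (fun S => ind (S.get 0 j = some Symbol.beta) *
        (ind (betaCount (κ + 2) S.tail + 1 = m) - ind (betaCount (κ + 2) S.tail = m))) := by
    rw [betaProb, betaProb,
      ← expect_tail ha hb (n := j + 1 + κ) (fun S => ind (betaCount (κ + 2) S = m)), ← expect_sub]
    refine expect_congr fun S => ?_
    rw [betaCount_succ (n := j + 1 + κ), show j + 1 + κ + 1 - (κ + 2) = j by omega]
    by_cases h : S.get 0 j = some Symbol.beta
    · rw [if_pos ⟨by omega, h⟩, ind_of h, one_mul]
    · rw [if_neg fun h' => h h'.2, ind_of_not h, zero_mul, add_zero, sub_self]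
  have h3 : expect j (a + κ) b (fun S => ind (betaCount (κ + 2) S + 1 = m) -
      ind (betaCount (κ + 2) S = m)) =
      (if m = 0 then 0 else betaProb κ b (m - 1) j (a + κ)) - betaProb κ b m j (a + κ) := by
    rw [expect_sub]
    congr 1
    cases m with
    | zero => simp [ind, expect]
    | succ m => simp [betaProb]
  rwa [← h2, h3] at h1

/-! ### The Poisson probabilities as functions of the mean -/

/-- The probability of `m` under the Poisson law of mean `x`. -/
noncomputable def poissonProb (m : ℕ) (x : ℝ) : ℝ := Real.exp (-x) * x ^ m / m.factorial

/-- The derivative of `poissonProb`. -/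
noncomputable def poissonDiff (m : ℕ) (x : ℝ) : ℝ :=
  (if m = 0 then 0 else poissonProb (m - 1) x) - poissonProb m x

theorem poissonProb_zero_right (m : ℕ) : poissonProb m 0 = if m = 0 then 1 else 0 := by
  cases m <;> simp [poissonProb]

theorem poissonProb_nonneg (m : ℕ) {x : ℝ} (hx : 0 ≤ x) : 0 ≤ poissonProb m x := by
  unfold poissonProb
  positivity

theorem poissonProb_le_one (m : ℕ) {x : ℝ} (hx : 0 ≤ x) : poissonProb m x ≤ 1 := by
  have h := Real.pow_div_factorial_le_exp x hx m
  calc poissonProb m x = Real.exp (-x) * (x ^ m / m.factorial) := mul_div_assoc _ _ _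
    _ ≤ Real.exp (-x) * Real.exp x := mul_le_mul_of_nonneg_left h (Real.exp_pos _).le
    _ = 1 := by rw [← Real.exp_add, neg_add_cancel, Real.exp_zero]

theorem abs_poissonDiff_le (m : ℕ) {x : ℝ} (hx : 0 ≤ x) : |poissonDiff m x| ≤ 1 := by
  have h1 := poissonProb_nonneg m hx
  have h2 := poissonProb_le_one m hx
  have h3 := poissonProb_nonneg (m - 1) hx
  have h4 := poissonProb_le_one (m - 1) hx
  unfold poissonDiff
  rw [abs_le]
  split_ifs <;> constructor <;> linarith

theorem hasDerivAt_poissonProb (m : ℕ) (x : ℝ) :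
    HasDerivAt (poissonProb m) (poissonDiff m x) x := by
  have h1 : HasDerivAt (fun x : ℝ => Real.exp (-x)) (-Real.exp (-x)) x := by
    simpa using (hasDerivAt_neg x).exp
  have h2 := (h1.mul (hasDerivAt_pow m x)).div_const (m.factorial : ℝ)
  refine h2.congr_deriv ?_
  cases m with
  | zero => simp [poissonDiff, poissonProb]
  | succ m =>
    have h3 : ((m + 1).factorial : ℝ) = (m + 1) * m.factorial := by
      rw [Nat.factorial_succ]
      push_cast
      ring
    have h4 : (m.factorial : ℝ) ≠ 0 := by positivity
    have h5 : (m : ℝ) + 1 ≠ 0 := by positivity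
    simp only [poissonDiff, poissonProb, Nat.succ_ne_zero, if_false, Nat.add_sub_cancel, h3]
    push_cast
    field_simp
    ring

theorem abs_poissonProb_sub_le (m : ℕ) {x y : ℝ} (hx : 0 ≤ x) (hy : 0 ≤ y) :
    |poissonProb m y - poissonProb m x| ≤ |y - x| := by
  have := (convex_Ici (0 : ℝ)).norm_image_sub_le_of_norm_hasDerivWithin_le (C := 1)
    (fun z _ => (hasDerivAt_poissonProb m z).hasDerivWithinAt)
    (fun z hz => abs_poissonDiff_le m hz) hx hy
  simpa using this

theorem abs_poissonDiff_sub_le (m : ℕ) {x y : ℝ} (hx : 0 ≤ x) (hy : 0 ≤ y) :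
    |poissonDiff m y - poissonDiff m x| ≤ 2 * |y - x| := by
  have h1 := abs_le.1 (abs_poissonProb_sub_le m hx hy)
  have h2 := abs_le.1 (abs_poissonProb_sub_le (m - 1) hx hy)
  have h3 := abs_nonneg (y - x)
  unfold poissonDiff
  rw [abs_le]
  split_ifs <;> constructor <;> linarith [h1.1, h1.2, h2.1, h2.2]

/-- The mean value inequality is applied to the function minus its linear part at x, whose
derivative is at most 2|y - x| between x and y. -/
theorem abs_poissonProb_sub_sub_le (m : ℕ) {x y : ℝ} (hx : 0 ≤ x) (hy : 0 ≤ y) :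
    |poissonProb m y - poissonProb m x - (y - x) * poissonDiff m x| ≤ 2 * (y - x) ^ 2 := by
  have h0 : Set.uIcc x y ⊆ Set.Ici 0 := fun z hz => (le_min hx hy).trans hz.1
  have := (convex_uIcc x y).norm_image_sub_le_of_norm_hasDerivWithin_le (C := 2 * |y - x|)
    (f := fun z => poissonProb m z - z * poissonDiff m x)
    (fun z _ => ((hasDerivAt_poissonProb m z).sub
      ((hasDerivAt_id z).mul_const _)).hasDerivWithinAt)
    (fun z hz => by
      rw [one_mul, Real.norm_eq_abs]
      refine (abs_poissonDiff_sub_le m hx (h0 hz)).trans ?_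
      have := Set.abs_sub_left_of_mem_uIcc hz
      linarith)
    Set.left_mem_uIcc Set.right_mem_uIcc
  rw [Real.norm_eq_abs, Real.norm_eq_abs, mul_assoc, abs_mul_abs_self] at this
  rw [pow_two]
  refine le_trans (le_of_eq ?_) this
  congr 1
  ring

/-! ### The mean of the approximating Poisson law -/

/-- The limit of the mean number of β's in the lowest rows that make up a proportion `x` of all
rows. -/
noncomputable def meanFun (x : ℝ) : ℝ := x - x ^ 2 / 2

theorem meanFun_nonneg {x : ℝ} (h0 : 0 ≤ x) (h1 : x ≤ 1) : 0 ≤ meanFun x := by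
  unfold meanFun
  nlinarith

theorem meanFun_le {x : ℝ} : meanFun x ≤ x := by
  unfold meanFun
  nlinarith [sq_nonneg x]

theorem abs_meanFun_sub_le {x y : ℝ} (hx0 : 0 ≤ x) (hx : x ≤ 1) (hy0 : 0 ≤ y) (hy : y ≤ 1) :
    |meanFun y - meanFun x| ≤ |y - x| := by
  have : meanFun y - meanFun x = (y - x) * (1 - (x + y) / 2) := by
    unfold meanFun
    ring
  rw [this, abs_mul]
  refine mul_le_of_le_one_right (abs_nonneg _) ?_
  rw [abs_le]
  constructor <;> linarith

/-- The mean increases by (a + b + 1/2)/s², which matches a/((s - 1)(s - 2)) up to O(1/s²).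
Evaluating the derivative at size j instead of the neighbouring size shifts the mean by O(1/s), and
this is multiplied by a coefficient O(1/s). -/
theorem poisson_consistency {a b K s : ℝ} {j κ : ℕ} (ha : 0 < a) (hb : 0 < b) (hbK : b ≤ K)
    (hs : s = a + b + j + κ + 2) (m : ℕ) :
    |poissonProb m (meanFun ((j + κ + 2) / s)) - poissonProb m (meanFun ((j + κ + 1) / s)) -
      a / ((s - 1) * (s - 2)) * poissonDiff m (meanFun (j / (s - 2)))| ≤
      (K + 19 + 4 * κ) / s ^ 2 := by
  have hκ : (0 : ℝ) ≤ κ := Nat.cast_nonneg κ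
  have hj : (0 : ℝ) ≤ j := Nat.cast_nonneg j
  have hs2 : 0 < s - 2 := by rw [hs]; linarith
  have hs1 : 0 < s - 1 := by linarith
  have hs0 : 0 < s := by linarith
  have hx1 : ((j : ℝ) + κ + 2) / s ≤ 1 := by rw [div_le_one hs0]; linarith
  have hx0 : ((j : ℝ) + κ + 1) / s ≤ 1 := by rw [div_le_one hs0]; linarith
  have hx2 : (j : ℝ) / (s - 2) ≤ 1 := by rw [div_le_one hs2]; linarith
  have hx1' : 0 ≤ ((j : ℝ) + κ + 2) / s := by positivity
  have hx0' : 0 ≤ ((j : ℝ) + κ + 1) / s := by positivity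
  have hx2' : 0 ≤ (j : ℝ) / (s - 2) := by positivity
  set u1 := meanFun ((j + κ + 2) / s) with hu1
  set u0 := meanFun ((j + κ + 1) / s) with hu0
  set u2 := meanFun (j / (s - 2)) with hu2
  set θ := a / ((s - 1) * (s - 2)) with hθ
  have p0 : 0 ≤ u0 := meanFun_nonneg hx0' hx0
  have p1 : 0 ≤ u1 := meanFun_nonneg hx1' hx1
  have p2 : 0 ≤ u2 := meanFun_nonneg hx2' hx2
  have hθ0 : 0 ≤ θ := by positivity
  have hθ1 : θ ≤ 2 / s := by
    rw [hθ, div_le_div_iff₀ (by positivity) hs0]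
    nlinarith
  have d1 : |u1 - u0| ≤ 1 / s := by
    refine (abs_meanFun_sub_le hx0' hx0 hx1' hx1).trans (le_of_eq ?_)
    rw [← sub_div, show (j : ℝ) + κ + 2 - (j + κ + 1) = 1 by ring, abs_of_pos (by positivity)]
  have d2 : |u2 - u0| ≤ (κ + 3) / s := by
    refine (abs_meanFun_sub_le hx0' hx0 hx2' hx2).trans ?_
    have h1 : (j : ℝ) / (s - 2) - (j + κ + 1) / s = 2 / s * (j / (s - 2)) - (κ + 1) / s := by
      field_simp
      ring
    have h2 : 2 / s * (j / (s - 2)) ≤ 2 / s := mul_le_of_le_one_right (by positivity) hx2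
    have h3 : 0 ≤ 2 / s * (j / (s - 2)) := by positivity
    have h4 : 0 ≤ (κ + 1) / s := by positivity
    have h5 : (κ + 3) / s = (κ + 1) / s + 2 / s := by ring
    rw [h1, h5, abs_le]
    constructor <;> linarith [show 0 < 2 / s by positivity]
  have d3 : |u1 - u0 - θ| ≤ (K + 5) / s ^ 2 := by
    have h1 : u1 - u0 - θ = (b + 1 / 2) / s ^ 2 - a / (s - 2) * ((3 * s - 2) / (s - 1)) / s ^ 2 := by
      have h2 : u1 - u0 = (2 * a + 2 * b + 1) / (2 * s ^ 2) := by
        rw [hu1, hu0, meanFun, meanFun, show (j : ℝ) = s - a - b - κ - 2 by linarith]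
        field_simp
        ring
      rw [h2, hθ]
      field_simp
      ring
    have h2 : a / (s - 2) ≤ 1 := by rw [div_le_one hs2]; linarith
    have h3 : (3 * s - 2) / (s - 1) ≤ 4 := by rw [div_le_iff₀ hs1]; linarith
    have h4 : 0 ≤ (3 * s - 2) / (s - 1) := div_nonneg (by linarith) hs1.le
    have h5 : a / (s - 2) * ((3 * s - 2) / (s - 1)) ≤ 1 * 4 :=
      mul_le_mul h2 h3 h4 (by norm_num)
    have h6 : 0 ≤ a / (s - 2) * ((3 * s - 2) / (s - 1)) := by positivity
    rw [h1, ← sub_div, abs_div, abs_of_pos (by positivity : 0 < s ^ 2)]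
    gcongr
    rw [abs_le]
    constructor <;> linarith
  have e1 := abs_poissonProb_sub_sub_le m p0 p1
  have e2 := abs_poissonDiff_le m p0
  have e3 := abs_poissonDiff_sub_le m p0 p2
  have e4 : (u1 - u0) ^ 2 ≤ 1 / s ^ 2 := by
    rw [← sq_abs, ← one_div_pow]
    gcongr
  have split : poissonProb m u1 - poissonProb m u0 - θ * poissonDiff m u2 =
      (poissonProb m u1 - poissonProb m u0 - (u1 - u0) * poissonDiff m u0) +
      ((u1 - u0 - θ) * poissonDiff m u0 + -(θ * (poissonDiff m u2 - poissonDiff m u0))) := by ring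
  rw [split]
  calc _ ≤ |poissonProb m u1 - poissonProb m u0 - (u1 - u0) * poissonDiff m u0| +
        (|(u1 - u0 - θ) * poissonDiff m u0| + |-(θ * (poissonDiff m u2 - poissonDiff m u0))|) :=
          (abs_add_le _ _).trans (add_le_add_right (abs_add_le _ _) _)
    -- Taylor remainder, mismatch of the means, shifted derivative: 2 + (K + 5) + 4(κ + 3) = K + 19
    -- + 4κ.
    _ ≤ 2 * (1 / s ^ 2) + ((K + 5) / s ^ 2 * 1 + 2 / s * (2 * ((κ + 3) / s))) := by
        gcongr
        · exact e1.trans (by linarith)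
        · rw [abs_mul]
          exact mul_le_mul d3 e2 (abs_nonneg _) ((abs_nonneg _).trans d3)
        · rw [abs_neg, abs_mul, abs_of_nonneg hθ0]
          exact mul_le_mul hθ1 (e3.trans (by linarith)) (abs_nonneg _) (by positivity)
    _ = _ := by
        field_simp
        ring

/-! ### Comparison with the Poisson probabilities -/

/-- The bound for the distance between the probabilities and the Poisson probabilities. -/
noncomputable def errorBound (A b : ℝ) (n : ℕ) (a : ℝ) : ℝ :=
  A / √(a + b + n) * (Real.exp (40 * (n / (a + b + n))) + 1 - √(a / (a + b + n)))

theorem le_errorBound {A a b : ℝ} (hA : 0 ≤ A) (ha : 0 < a) (hb : 0 < b) (n : ℕ) :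
    A / √(a + b + n) ≤ errorBound A b n a := by
  have h1 : √(a / (a + b + n)) ≤ 1 := by
    refine Real.sqrt_le_one.2 ?_
    rw [div_le_one (by positivity)]
    linarith [(Nat.cast_nonneg n : (0 : ℝ) ≤ n)]
  have h2 : 1 ≤ Real.exp (40 * (n / (a + b + n))) := Real.one_le_exp (by positivity)
  exact le_mul_of_one_le_right (by positivity) (by linarith)

/-- The difference √(a + 1) - √a is 1/(√(a + 1) + √a), and each root is at most 1 + a. This gain
absorbs the error of order 1/((1 + a)s) in each step. -/
theorem sqrt_add_one_sub_sqrt {a s : ℝ} (ha : 0 < a) (hs : 0 < s) :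
    1 / (√s * (2 * (1 + a))) ≤ √((a + 1) / s) - √(a / s) := by
  rw [Real.sqrt_div (by positivity), Real.sqrt_div ha.le, ← sub_div, mul_comm, ← div_div]
  gcongr
  have h1 : (√(a + 1)) ^ 2 = a + 1 := Real.sq_sqrt (by positivity)
  have h2 : (√a) ^ 2 = a := Real.sq_sqrt ha.le
  have h3 : √a ≤ √(a + 1) := Real.sqrt_le_sqrt (by linarith)
  have h4 : √(a + 1) ≤ 1 + a := by rw [Real.sqrt_le_left (by positivity)]; nlinarith
  have h5 := Real.sqrt_nonneg a
  rw [div_le_iff₀ (by positivity)]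
  have h6 : (√(a + 1) - √a) * (√(a + 1) + √a) = 1 := by linear_combination h1 - h2
  have h7 := mul_le_mul_of_nonneg_left (show √(a + 1) + √a ≤ 2 * (1 + a) by linarith)
    (show 0 ≤ √(a + 1) - √a by linarith)
  linarith

/-- With s fixed, passing from (n - 1, a + 1) to (n, a) increases both parts of the bound: the term
-√(a/s) grows enough for the local error C/((1 + a)s), and the exponential gains a factor e^(40/s),
enough for the error inherited from size j. -/
theorem errorBound_step {A C a b s : ℝ} {j κ : ℕ} (hC : 2 * C ≤ A) (hA : 0 ≤ A) (ha : 0 < a)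
    (hb : 0 < b) (hs : s = a + b + j + κ + 2) (h42 : 42 < s) :
    errorBound A b (j + 1 + κ) (a + 1) + C / ((1 + a) * s) +
      a / ((s - 1) * (s - 2)) * (2 * errorBound A b j (a + κ)) ≤
      errorBound A b (j + 1 + κ + 1) a := by
  have hκ : (0 : ℝ) ≤ κ := Nat.cast_nonneg κ
  have hj : (0 : ℝ) ≤ j := Nat.cast_nonneg j
  have hs2 : 0 < s - 2 := by linarith
  have hs0 : 0 < s := by linarith
  have r0 : a + 1 + b + ((j + 1 + κ : ℕ) : ℝ) = s := by rw [hs]; push_cast; ring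
  have r1 : a + b + ((j + 1 + κ + 1 : ℕ) : ℝ) = s := by rw [hs]; push_cast; ring
  have r2 : a + κ + b + (j : ℝ) = s - 2 := by rw [hs]; ring
  rw [errorBound, errorBound, errorBound, r0, r1, r2]
  set E := Real.exp (40 * (((j + 1 + κ : ℕ) : ℝ) / s)) with hE
  have hE1 : 1 ≤ E := Real.one_le_exp (by positivity)
  have g1 : E + 40 / s * E ≤ Real.exp (40 * (((j + 1 + κ + 1 : ℕ) : ℝ) / s)) := by
    have h1 : (40 : ℝ) * (((j + 1 + κ + 1 : ℕ) : ℝ) / s) =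
        40 * (((j + 1 + κ : ℕ) : ℝ) / s) + 40 / s := by
      push_cast
      ring
    rw [h1, Real.exp_add, ← hE]
    nlinarith [Real.add_one_le_exp (40 / s)]
  have g2 := sqrt_add_one_sub_sqrt ha hs0
  have g3 : Real.exp (40 * ((j : ℝ) / (s - 2))) ≤ 3 * E := by
    have h1 : (40 : ℝ) * ((j : ℝ) / (s - 2)) ≤ 1 + 40 * (((j + 1 + κ : ℕ) : ℝ) / s) := by
      have h2 : (j : ℝ) / (s - 2) = j / s + 2 / s * (j / (s - 2)) := by
        field_simp
        ring
      have h3 : (j : ℝ) / (s - 2) ≤ 1 := by rw [div_le_one hs2]; linarith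
      have h4 : 2 / s * (j / (s - 2)) ≤ 2 / s := mul_le_of_le_one_right (by positivity) h3
      -- Here s must be at least 40.
      have h5 : 2 / s ≤ 1 / 40 + 1 / s := by
        rw [← sub_le_iff_le_add, ← sub_div, div_le_div_iff₀ hs0 (by norm_num)]
        linarith
      have h6 : ((j + 1 + κ : ℕ) : ℝ) / s = j / s + 1 / s + κ / s := by
        push_cast
        ring
      have h7 : 0 ≤ (κ : ℝ) / s := by positivity
      rw [h6]
      linarith
    calc _ ≤ Real.exp (1 + 40 * (((j + 1 + κ : ℕ) : ℝ) / s)) := Real.exp_le_exp.2 h1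
      _ = Real.exp 1 * E := Real.exp_add _ _
      _ ≤ 3 * E := by
        gcongr
        linarith [Real.exp_one_lt_d9]
  have g4 : a / ((s - 1) * (s - 2)) ≤ 2 / s := by
    rw [div_le_div_iff₀ (mul_pos (by linarith) hs2) hs0]
    nlinarith
  have g5 : A / √(s - 2) ≤ 2 * (A / √s) := by
    have h1 : √s ≤ 2 * √(s - 2) := by
      rw [Real.sqrt_le_left (by positivity), mul_pow, Real.sq_sqrt hs2.le]
      linarith
    rw [← mul_div_assoc, div_le_div_iff₀ (Real.sqrt_pos.2 hs2) (Real.sqrt_pos.2 hs0)]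
    nlinarith
  have g6 : a / ((s - 1) * (s - 2)) * (2 * (A / √(s - 2) *
      (Real.exp (40 * ((j : ℝ) / (s - 2))) + 1 - √((a + κ) / (s - 2))))) ≤
      A / √s * (40 / s * E) := by
    have h0 := Real.sqrt_nonneg ((a + κ) / (s - 2))
    have h1 : √((a + κ) / (s - 2)) ≤ 1 := by
      refine Real.sqrt_le_one.2 ?_
      rw [div_le_one hs2]
      linarith
    -- The constants multiply to 2 · 2 · 2 · 4 = 32, which is below 40.
    calc _ ≤ 2 / s * (2 * (2 * (A / √s) * (4 * E))) := by
          refine mul_le_mul g4 (mul_le_mul_of_nonneg_left (mul_le_mul g5 (by linarith) ?_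
            (by positivity)) (by norm_num)) ?_ (by positivity)
          · linarith [Real.exp_pos (40 * ((j : ℝ) / (s - 2)))]
          · have : 0 ≤ Real.exp (40 * ((j : ℝ) / (s - 2))) + 1 - √((a + κ) / (s - 2)) := by
              linarith [Real.exp_pos (40 * ((j : ℝ) / (s - 2)))]
            positivity
      _ = A / √s * (32 / s * E) := by ring
      _ ≤ _ := by gcongr; norm_num
  have g7 : C / ((1 + a) * s) ≤ A / √s * (1 / (√s * (2 * (1 + a)))) := by
    calc C / ((1 + a) * s) ≤ A / 2 / ((1 + a) * s) := by gcongr; linarith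
      _ = A / ((√s * √s) * (2 * (1 + a))) := by
          rw [Real.mul_self_sqrt hs0.le]
          field_simp
      _ = _ := by
          field_simp
  calc _ ≤ A / √s * (E + 1 - √((a + 1) / s)) + A / √s * (1 / (√s * (2 * (1 + a)))) +
        A / √s * (40 / s * E) := by gcongr
    _ = A / √s * ((E + 40 / s * E) + 1 - √((a + 1) / s) + 1 / (√s * (2 * (1 + a)))) := by ring
    _ ≤ _ := by
        refine mul_le_mul_of_nonneg_left ?_ (by positivity)
        linarith

/-- Strong induction on n, for all a and m at once: the recursion refers to sizes n - 1 and n - κ -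
2, with parameters a + 1 and a + κ and with m - 1. -/
theorem abs_betaProb_sub_poissonProb_le (κ : ℕ) (K : ℝ) (hK : 0 ≤ K) :
    ∃ A : ℝ, 0 ≤ A ∧ ∀ b : ℝ, 0 < b → b ≤ K → ∀ (n : ℕ) (a : ℝ), 0 < a → ∀ m : ℕ,
      |betaProb κ b m n a - poissonProb m (meanFun (n / (a + b + n)))| ≤ errorBound A b n a := by
  set C₀ : ℝ := 2 * (κ * (3 * (1 + 2 * κ) ^ 2)) with hC₀
  set C₁ : ℝ := 2 * C₀ + (K + 19 + 4 * κ) with hC₁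
  have hκ : (0 : ℝ) ≤ κ := Nat.cast_nonneg κ
  have hC₀0 : 0 ≤ C₀ := by positivity
  have hC₁0 : 0 ≤ C₁ := by positivity
  have hA0 : 0 ≤ 2 * C₁ + κ + 7 := by positivity
  refine ⟨2 * C₁ + κ + 7, hA0, fun b hb hbK n => ?_⟩
  induction n using Nat.strong_induction_on with
  | _ n ih =>
  intro a ha m
  have hs0 : 0 < a + b + (n : ℝ) := by positivity
  have hx0 : 0 ≤ (n : ℝ) / (a + b + n) := by positivity
  have hx1 : (n : ℝ) / (a + b + n) ≤ 1 := by rw [div_le_one hs0]; linarith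
  have hu0 := meanFun_nonneg hx0 hx1
  -- For small s the trivial bound 1 suffices, since √s ≤ 7 ≤ A.
  rcases le_or_gt (a + b + (n : ℝ)) 42 with h42 | h42
  · refine le_trans ?_ (le_errorBound hA0 ha hb n)
    have h1 : √(a + b + n) ≤ 7 := by
      rw [Real.sqrt_le_left (by norm_num)]
      linarith
    have h2 : 1 ≤ (2 * C₁ + κ + 7) / √(a + b + n) := by
      rw [one_le_div (Real.sqrt_pos.2 hs0)]
      linarith
    refine le_trans ?_ h2
    have := betaProb_nonneg ha hb κ m n
    have := betaProb_le_one ha hb κ m n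
    have := poissonProb_nonneg m hu0
    have := poissonProb_le_one m hu0
    rw [abs_le]
    constructor <;> linarith
  -- Below size κ + 2 the diagonal has no boxes, so the count is 0, and the Poisson mean is at most
  -- (κ + 1)/s.
  rcases lt_or_ge n (κ + 2) with hn | hn
  · refine le_trans ?_ (le_errorBound hA0 ha hb n)
    rw [betaProb_of_lt ha hb hn, ← poissonProb_zero_right, abs_sub_comm]
    refine (abs_poissonProb_sub_le m le_rfl hu0).trans ?_
    rw [sub_zero, abs_of_nonneg hu0]
    refine meanFun_le.trans ?_
    have h1 : √(a + b + n) ≤ a + b + n := by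
      rw [Real.sqrt_le_left hs0.le]
      nlinarith
    have h2 : (n : ℝ) ≤ κ + 1 := by exact_mod_cast Nat.lt_succ_iff.1 hn
    exact div_le_div₀ hA0 (by linarith) (Real.sqrt_pos.2 hs0) h1
  · obtain ⟨j, rfl⟩ : ∃ j, n = j + 1 + κ + 1 := ⟨n - (κ + 2), by omega⟩
    set s : ℝ := a + b + j + κ + 2 with hs
    have hj : (0 : ℝ) ≤ j := Nat.cast_nonneg j
    have r1 : a + b + ((j + 1 + κ + 1 : ℕ) : ℝ) = s := by rw [hs]; push_cast; ring
    have r0 : a + 1 + b + ((j + 1 + κ : ℕ) : ℝ) = s := by rw [hs]; push_cast; ring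
    have r2 : a + κ + b + (j : ℝ) = s - 2 := by rw [hs]; ring
    have r3 : ((j + 1 + κ + 1 : ℕ) : ℝ) = j + κ + 2 := by push_cast; ring
    have r4 : ((j + 1 + κ : ℕ) : ℝ) = j + κ + 1 := by push_cast; ring
    rw [r1] at h42
    have i0 := ih (j + 1 + κ) (by omega) (a + 1) (by linarith) m
    have i2 := fun m => ih j (by omega) (a + κ) (by positivity) m
    rw [r0, r4] at i0
    simp only [r2] at i2
    have e1 := abs_betaProb_succ_sub_le ha hb κ j m
    have e2 := poisson_consistency ha hb hbK hs m
    have e3 := errorBound_step (κ := κ) (j := j) (C := C₁) (A := 2 * C₁ + κ + 7) (by linarith)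
      hA0 ha hb hs h42
    rw [show a + b + j + κ + 1 = s - 1 by rw [hs]; ring,
      show a + b + j + κ = s - 2 by rw [hs]; ring] at e1
    rw [r1, r3]
    refine le_trans ?_ e3
    set P1 := betaProb κ b m (j + 1 + κ + 1) a
    set P0 := betaProb κ b m (j + 1 + κ) (a + 1)
    set D := (if m = 0 then 0 else betaProb κ b (m - 1) j (a + κ)) - betaProb κ b m j (a + κ)
    set Q1 := poissonProb m (meanFun ((j + κ + 2) / s))
    set Q0 := poissonProb m (meanFun ((j + κ + 1) / s))
    set θ := a / ((s - 1) * (s - 2)) with hθ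
    have hθ0 : 0 ≤ θ := div_nonneg ha.le (mul_nonneg (by linarith) (by linarith))
    have e4 : |D - poissonDiff m (meanFun (j / (s - 2)))| ≤
        2 * errorBound (2 * C₁ + κ + 7) b j (a + κ) := by
      have h1 := abs_le.1 (i2 m)
      have h2 := abs_le.1 (i2 (m - 1))
      unfold D poissonDiff
      rw [abs_le]
      split_ifs <;> constructor <;> linarith [h1.1, h1.2, h2.1, h2.2]
    -- Uses s ≤ 2(s - 2) and 1 + a ≤ s.
    have e5 : C₀ / ((1 + a) * (s - 2)) + (K + 19 + 4 * κ) / s ^ 2 ≤ C₁ / ((1 + a) * s) := by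
      have h1 : C₀ / ((1 + a) * (s - 2)) ≤ 2 * C₀ / ((1 + a) * s) := by
        rw [div_le_div_iff₀ (mul_pos (by linarith) (by linarith)) (by positivity)]
        have : 0 ≤ C₀ * (1 + a) * (s - 4) :=
          mul_nonneg (by positivity) (by linarith)
        linarith
      have h2 : (K + 19 + 4 * κ) / s ^ 2 ≤ (K + 19 + 4 * κ) / ((1 + a) * s) := by
        rw [pow_two]
        gcongr
        linarith
      have h3 : C₁ / ((1 + a) * s) =
          2 * C₀ / ((1 + a) * s) + (K + 19 + 4 * κ) / ((1 + a) * s) := by rw [hC₁, add_div]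
      rw [h3]
      exact add_le_add h1 h2
    have e6 : |θ * (D - poissonDiff m (meanFun (j / (s - 2))))| ≤
        θ * (2 * errorBound (2 * C₁ + κ + 7) b j (a + κ)) := by
      rw [abs_mul, abs_of_nonneg hθ0]
      exact mul_le_mul_of_nonneg_left e4 hθ0
    rw [mul_sub] at e6
    have f0 := abs_le.1 i0
    have f1 := abs_le.1 e1
    have f2 := abs_le.1 e2
    have f6 := abs_le.1 e6
    rw [abs_le]
    constructor <;> linarith [f0.1, f0.2, f1.1, f1.2, f2.1, f2.2, f6.1, f6.2]

/-- The probabilities converge to the Poisson probabilities, uniformly for bounded inverse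
parameters. -/
theorem abs_betaProb_sub_le (κ : ℕ) (K : ℝ) (hK : 0 ≤ K) :
    ∃ A : ℝ, ∀ a b : ℝ, 0 < a → a ≤ K → 0 < b → b ≤ K → ∀ n : ℕ, 0 < n → ∀ m : ℕ,
      |betaProb κ b m n a - poissonProb m (1 / 2)| ≤ A / √n := by
  obtain ⟨A, hA, h⟩ := abs_betaProb_sub_poissonProb_le κ K hK
  refine ⟨A * (Real.exp 40 + 1) + 2 * K, fun a b ha haK hb hbK n hn m => ?_⟩
  have hn0 : (0 : ℝ) < n := Nat.cast_pos.2 hn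
  have hn1 : (1 : ℝ) ≤ n := Nat.one_le_cast.2 hn
  have hs0 : 0 < a + b + (n : ℝ) := by positivity
  have hx0 : 0 ≤ (n : ℝ) / (a + b + n) := by positivity
  have hx1 : (n : ℝ) / (a + b + n) ≤ 1 := by rw [div_le_one hs0]; linarith
  have hsq : 0 < √(n : ℝ) := Real.sqrt_pos.2 hn0
  have h1 := h b hb hbK n a ha m
  have h2 : errorBound A b n a ≤ A * (Real.exp 40 + 1) / √n := by
    have h3 : √(n : ℝ) ≤ √(a + b + n) := Real.sqrt_le_sqrt (by linarith)
    have h4 : Real.exp (40 * (n / (a + b + n))) ≤ Real.exp 40 := Real.exp_le_exp.2 (by linarith)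
    have h5 := Real.sqrt_nonneg (a / (a + b + n))
    calc errorBound A b n a ≤ A / √(a + b + n) * (Real.exp 40 + 1) :=
          mul_le_mul_of_nonneg_left (by linarith) (by positivity)
      _ ≤ A / √n * (Real.exp 40 + 1) := by gcongr
      _ = _ := by ring
  have h3 := abs_poissonProb_sub_le m (by norm_num : (0 : ℝ) ≤ 1 / 2) (meanFun_nonneg hx0 hx1)
  -- The mean falls short of 1/2 by exactly half the square of (a + b)/s.
  have h4 : |meanFun (n / (a + b + n)) - 1 / 2| ≤ 2 * K / √n := by
    have h5 : meanFun (n / (a + b + n)) - 1 / 2 = -((a + b) / (a + b + n)) ^ 2 / 2 := by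
      unfold meanFun
      field_simp
      ring
    have h6 : (a + b) / (a + b + n) ≤ 1 := by rw [div_le_one hs0]; linarith
    have h7 : 0 ≤ (a + b) / (a + b + n) := by positivity
    have h8 : √(n : ℝ) ≤ a + b + n := by
      have : √(n : ℝ) ≤ n := by
        rw [Real.sqrt_le_left hn0.le]
        nlinarith
      linarith
    have h9 : (a + b) / (a + b + n) ≤ 2 * K / √n :=
      div_le_div₀ (by positivity) (by linarith) hsq h8
    rw [h5, abs_le]
    constructor <;> nlinarith
  have h5 : (A * (Real.exp 40 + 1) + 2 * K) / √n =
      A * (Real.exp 40 + 1) / √n + 2 * K / √n := add_div _ _ _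
  have f1 := abs_le.1 h1
  have f3 := abs_le.1 h3
  rw [h5, abs_le]
  constructor <;> linarith [f1.1, f1.2, f3.1, f3.2]

/-! ### Convergence in distribution -/

/-- Probability measures on `ℕ` converge weakly if the probabilities of all points converge. -/
theorem tendsto_probabilityMeasure_of_singleton {μs : ℕ → ProbabilityMeasure ℕ}
    {μ : ProbabilityMeasure ℕ}
    (h : ∀ m, Tendsto (fun n => (μs n : Measure ℕ) {m}) atTop (𝓝 ((μ : Measure ℕ) {m}))) :
    Tendsto μs atTop (𝓝 μ) := by
  classical
  -- By the portmanteau theorem a lower bound on open sets is enough; G is exhausted by finite sets,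
  -- on which convergence is a finite sum.
  refine tendsto_of_forall_isOpen_le_liminf' fun G _ => ?_
  have h1 : ∀ N : ℕ, (μ : Measure ℕ) (G ∩ Set.Iio N) ≤
      atTop.liminf fun n => (μs n : Measure ℕ) G := by
    intro N
    have h2 : G ∩ Set.Iio N = ((Finset.range N).filter (· ∈ G) : Finset ℕ) := by
      ext x
      simp [and_comm]
    have h3 : Tendsto (fun n => (μs n : Measure ℕ) (G ∩ Set.Iio N)) atTop
        (𝓝 ((μ : Measure ℕ) (G ∩ Set.Iio N))) := by
      simp_rw [h2, ← sum_measure_singleton]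
      exact tendsto_finsetSum _ fun m _ => h m
    rw [← h3.liminf_eq]
    exact liminf_le_liminf (Eventually.of_forall fun n => measure_mono Set.inter_subset_left)
  have h4 : Tendsto (fun N : ℕ => (μ : Measure ℕ) (G ∩ Set.Iio N)) atTop
      (𝓝 ((μ : Measure ℕ) (⋃ N : ℕ, G ∩ Set.Iio N))) := by
    refine tendsto_measure_iUnion_atTop fun N N' hN => ?_
    exact Set.inter_subset_inter_right _ (Set.Iio_subset_Iio hN)
  have h5 : ⋃ N : ℕ, G ∩ Set.Iio N = G := by
    ext x
    simp only [Set.mem_iUnion, Set.mem_inter_iff, Set.mem_Iio]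
    exact ⟨fun ⟨_, h, _⟩ => h, fun h => ⟨x + 1, h, Nat.lt_succ_self x⟩⟩
  rw [h5] at h4
  exact le_of_tendsto' h4 h1

theorem toMeasure_betaCount_eq {n : ℕ} (k m : ℕ) (P : PMF (Tableau n)) :
    P.toMeasure.map (fun S : Tableau n => betaCount k S) {m} =
      ENNReal.ofReal (∑ S, (P S).toReal * ind (betaCount k S = m)) := by
  rw [Measure.map_apply (measurable_of_finite _) (measurableSet_singleton m),
    PMF.toMeasure_apply_fintype,
    ENNReal.ofReal_sum_of_nonneg fun S _ => mul_nonneg ENNReal.toReal_nonneg (ind_nonneg _)]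
  refine Finset.sum_congr rfl fun S _ => ?_
  by_cases h : betaCount k S = m
  · rw [Set.indicator_of_mem (by simpa using h), ind_of h, mul_one,
      ENNReal.ofReal_toReal (P.apply_ne_top S)]
  · rw [Set.indicator_of_notMem (by simpa using h), ind_of_not h, mul_zero, ENNReal.ofReal_zero]

theorem tendstoInDistribution_of_tendsto_sum (k : ℕ) (P : (n : ℕ) → PMF (Tableau n))
    (h : ∀ m, Tendsto (fun n => ∑ S, (P n S).toReal * ind (betaCount k S = m)) atTop
      (𝓝 (poissonProb m (1 / 2)))) :
    TendstoInDistribution (fun (n : ℕ) (S : Tableau n) => betaCount k S)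
      atTop (fun m : ℕ => m) (fun n => (P n).toMeasure) (poissonMeasure (1 / 2)) where
  forall_aemeasurable n := (measurable_of_finite _).aemeasurable
  aemeasurable_limit := measurable_id.aemeasurable
  tendsto := by
    refine tendsto_probabilityMeasure_of_singleton fun m => ?_
    change Tendsto (fun n => (P n).toMeasure.map (fun S : Tableau n => betaCount k S) {m}) atTop
      (𝓝 ((poissonMeasure (1 / 2)).map id {m}))
    simp_rw [toMeasure_betaCount_eq]
    rw [Measure.map_id, poissonMeasure_singleton]
    have h1 : poissonProb m (1 / 2) =
        Real.exp (-((1 / 2 : NNReal) : ℝ)) * ((1 / 2 : NNReal) : ℝ) ^ m / m.factorial := by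
      simp [poissonProb]
    rw [← h1]
    exact ENNReal.tendsto_ofReal (h m)

/-- The limit theorem for the limit laws along all parameters that stay away from `0`. -/
theorem IsLimitLaw.tendstoInDistribution {α β : ℝ → ℝ} {P : (n : ℕ) → PMF (Tableau n)}
    (hP : IsLimitLaw α β P) {c : ℝ} (hc : 0 < c) (hα : ∀ᶠ t in atTop, c ≤ α t)
    (hβ : ∀ᶠ t in atTop, c ≤ β t) {k : ℕ} (hk : 1 < k) :
    TendstoInDistribution (fun (n : ℕ) (S : Tableau n) => betaCount k S)
      atTop (fun m : ℕ => m) (fun n => (P n).toMeasure) (poissonMeasure (1 / 2)) := by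
  obtain ⟨κ, rfl⟩ : ∃ κ, k = κ + 2 := ⟨k - 2, by omega⟩
  refine tendstoInDistribution_of_tendsto_sum _ P fun m => ?_
  obtain ⟨A, hA⟩ := abs_betaProb_sub_le κ c⁻¹ (by positivity)
  have h1 : ∀ n : ℕ, 0 < n →
      |∑ S, (P n S).toReal * ind (betaCount (κ + 2) S = m) - poissonProb m (1 / 2)| ≤ A / √n := by
    intro n hn
    have h2 : Tendsto (fun t => ∑ S, tableauProb n (α t) (β t) S * ind (betaCount (κ + 2) S = m))
        atTop (𝓝 (∑ S, (P n S).toReal * ind (betaCount (κ + 2) S = m))) :=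
      tendsto_finsetSum _ fun S _ => (hP n S).mul_const _
    -- The bound depends on the parameters only through c, so it survives the limit in t at each
    -- fixed n.
    refine le_of_tendsto (h2.sub_const _).abs ?_
    filter_upwards [hα, hβ] with t h3 h4
    have h5 : 0 < α t := hc.trans_le h3
    have h6 : 0 < β t := hc.trans_le h4
    simp_rw [tableauProb_eq h5 h6]
    exact hA _ _ (inv_pos.2 h5) (inv_anti₀ hc h3) (inv_pos.2 h6) (inv_anti₀ hc h4) n hn m
  have h2 : Tendsto (fun n : ℕ => A / √(n : ℝ)) atTop (𝓝 0) :=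
    tendsto_const_nhds.div_atTop (Real.tendsto_sqrt_atTop.comp tendsto_natCast_atTop_atTop)
  rw [tendsto_iff_dist_tendsto_zero]
  refine squeeze_zero' (Eventually.of_forall fun _ => dist_nonneg) ?_ h2
  filter_upwards [eventually_gt_atTop 0] with n hn
  exact h1 n hn

/-! ### Existence of the limit laws -/

theorem sum_tableauProb {n : ℕ} {α β : ℝ} (hα : 0 < α) (hβ : 0 < β) :
    ∑ S : Tableau n, tableauProb n α β S = 1 := by
  simp only [tableauProb]
  rw [← Finset.sum_div]
  exact div_self (partitionFunction_pos n hα hβ).ne'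

/-- There are finitely many tableaux of each size, so no mass is lost in the limit. -/
theorem exists_isLimitLaw {α β : ℝ → ℝ} (hα : ∀ᶠ t in atTop, 0 < α t)
    (hβ : ∀ᶠ t in atTop, 0 < β t)
    (h : ∀ n (S : Tableau n), ∃ L, Tendsto (fun t => tableauProb n (α t) (β t) S) atTop (𝓝 L)) :
    ∃ P : (n : ℕ) → PMF (Tableau n), IsLimitLaw α β P := by
  choose L hL using h
  have h0 : ∀ n S, 0 ≤ L n S := fun n S => by
    refine ge_of_tendsto (hL n S) ?_
    filter_upwards [hα, hβ] with t h1 h2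
    exact div_nonneg (S.weight_pos h1 h2).le (partitionFunction_pos n h1 h2).le
  have h1 : ∀ n, ∑ S, L n S = 1 := fun n => by
    refine tendsto_nhds_unique (tendsto_finsetSum _ fun S _ => hL n S) ?_
    refine tendsto_const_nhds.congr' ?_
    filter_upwards [hα, hβ] with t h1 h2
    exact (sum_tableauProb h1 h2).symm
  refine ⟨fun n => PMF.ofFintype (fun S => ENNReal.ofReal (L n S)) ?_, fun n S => ?_⟩
  · rw [← ENNReal.ofReal_sum_of_nonneg fun S _ => h0 n S, h1, ENNReal.ofReal_one]
  · rw [PMF.ofFintype_apply, ENNReal.toReal_ofReal (h0 n S)]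
    exact hL n S

theorem isLimitLaw_law {α β : ℝ} (hα : 0 < α) (hβ : 0 < β) :
    IsLimitLaw (fun _ => α) (fun _ => β) fun n => law n α β hα hβ := by
  intro n S
  have h : law n α β hα hβ S = ENNReal.ofReal (tableauProb n α β S) := rfl
  simp only [h, ENNReal.toReal_ofReal
    (show 0 ≤ tableauProb n α β S from div_nonneg (S.weight_pos hα hβ).le (partitionFunction_pos n hα hβ).le)]
  exact tendsto_const_nhds

theorem continuous_normConst (n : ℕ) : Continuous fun x : ℝ × ℝ => normConst n x.1 x.2 := by
  unfold normConst
  fun_prop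

theorem tendsto_prob {n : ℕ} (S : Tableau n) {a b : ℝ → ℝ} {a₀ b₀ : ℝ}
    (ha : Tendsto a atTop (𝓝 a₀)) (hb : Tendsto b atTop (𝓝 b₀))
    (hab : 0 < a₀ + b₀) : ∃ L, Tendsto (fun t => prob (a t) (b t) S) atTop (𝓝 L) := by
  have hZ : normConst n a₀ b₀ ≠ 0 :=
    (Finset.prod_pos fun i _ => add_pos_of_pos_of_nonneg hab i.cast_nonneg).ne'
  exact ⟨_, ((ha.pow _).mul (hb.pow _)).div
    (((continuous_normConst n).tendsto (a₀, b₀)).comp (ha.prodMk_nhds hb)) hZ⟩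

/-- If the top row has leftmost symbol α, the row has no β; if it is β, its column has no α. -/
theorem one_le_card_free_add_freeRows {n : ℕ} (S : Tableau (n + 1)) :
    1 ≤ S.free.card + S.freeRows := by
  have hT := S.topSet_subset
  rw [← S.cons_tail, Tableau.freeRows_cons _ hT]
  cases S.topSymbol with
  | alpha =>
    rw [if_pos rfl]
    omega
  | beta =>
    rw [Tableau.card_free_cons_beta _ hT]
    omega

/-- For positive size the normalising constant vanishes to first order at a = b = 0, through its
factor 2a. The numerator contains at least one power of a, which cancels it. -/
theorem tendsto_prob_self {n : ℕ} (S : Tableau n) {a : ℝ → ℝ} (h0 : ∀ᶠ t in atTop, 0 < a t)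
    (ha : Tendsto a atTop (𝓝 0)) : ∃ L, Tendsto (fun t => prob (a t) (a t) S) atTop (𝓝 L) := by
  cases n with
  | zero =>
    exact ⟨_, by simpa [prob, normConst] using (ha.pow S.free.card).mul (ha.pow S.freeRows)⟩
  | succ n =>
    obtain ⟨e, he⟩ := Nat.exists_eq_add_of_le' (one_le_card_free_add_freeRows S)
    have hZ : 2 * normConst n (0 + 1) 0 ≠ 0 :=
      (mul_pos two_pos (Finset.prod_pos fun i _ => by positivity)).ne'
    refine ⟨_, ((ha.pow e).div ((((continuous_normConst n).tendsto (0 + 1, 0)).comp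
      ((ha.add_const 1).prodMk_nhds ha)).const_mul 2) hZ).congr' ?_⟩
    filter_upwards [h0] with t ht
    rw [prob, ← pow_add, he, normConst_succ, pow_succ]
    simp only [Function.comp_apply]
    rw [Pi.div_apply, ← mul_div_mul_right _ _ ht.ne']
    congr 1
    ring

end Staircase

theorem corollary4p3 (k : ℕ) (hk : 1 < k) :
    -- finite parameters `α, β`
    (∀ (α β : ℝ) (hα : 0 < α) (hβ : 0 < β),
      TendstoInDistribution (fun (n : ℕ) (S : Staircase.Tableau n) => Staircase.betaCount k S)
        atTop (fun m : ℕ => m)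
        (fun n => (Staircase.law n α β hα hβ).toMeasure) (poissonMeasure (1 / 2))) ∧
    -- `α = ∞`, `β` fixed
    (∀ β : ℝ, 0 < β → ∃ P : (n : ℕ) → PMF (Staircase.Tableau n),
      Staircase.IsLimitLaw (fun t => t) (fun _ => β) P ∧
      TendstoInDistribution (fun (n : ℕ) (S : Staircase.Tableau n) => Staircase.betaCount k S)
        atTop (fun m : ℕ => m) (fun n => (P n).toMeasure) (poissonMeasure (1 / 2))) ∧
    -- `β = ∞`, `α` fixed
    (∀ α : ℝ, 0 < α → ∃ P : (n : ℕ) → PMF (Staircase.Tableau n),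
      Staircase.IsLimitLaw (fun _ => α) (fun t => t) P ∧
      TendstoInDistribution (fun (n : ℕ) (S : Staircase.Tableau n) => Staircase.betaCount k S)
        atTop (fun m : ℕ => m) (fun n => (P n).toMeasure) (poissonMeasure (1 / 2))) ∧
    -- `α = β = ∞`
    (∃ P : (n : ℕ) → PMF (Staircase.Tableau n),
      Staircase.IsLimitLaw (fun t => t) (fun t => t) P ∧
      TendstoInDistribution (fun (n : ℕ) (S : Staircase.Tableau n) => Staircase.betaCount k S)
        atTop (fun m : ℕ => m) (fun n => (P n).toMeasure) (poissonMeasure (1 / 2))) := by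
  have hpos : ∀ᶠ t : ℝ in atTop, 0 < t := eventually_gt_atTop 0
  refine ⟨fun α β hα hβ => ?_, fun β hβ => ?_, fun α hα => ?_, ?_⟩
  · exact (Staircase.isLimitLaw_law hα hβ).tendstoInDistribution (lt_min hα hβ)
      (Eventually.of_forall fun _ => min_le_left _ _)
      (Eventually.of_forall fun _ => min_le_right _ _) hk
  · obtain ⟨P, hP⟩ := Staircase.exists_isLimitLaw (α := fun t => t) (β := fun _ => β) hpos
      (Eventually.of_forall fun _ => hβ) fun n S => by
        obtain ⟨L, hL⟩ := Staircase.tendsto_prob S tendsto_inv_atTop_zero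
          (tendsto_const_nhds (x := β⁻¹))
          (add_pos_of_nonneg_of_pos le_rfl (inv_pos.2 hβ))
        refine ⟨L, hL.congr' ?_⟩
        filter_upwards [hpos] with t ht
        exact (Staircase.tableauProb_eq ht hβ S).symm
    exact ⟨P, hP, hP.tendstoInDistribution hβ (eventually_ge_atTop β)
      (Eventually.of_forall fun _ => le_rfl) hk⟩
  · obtain ⟨P, hP⟩ := Staircase.exists_isLimitLaw (α := fun _ => α) (β := fun t => t)
      (Eventually.of_forall fun _ => hα) hpos fun n S => by
        obtain ⟨L, hL⟩ := Staircase.tendsto_prob S (tendsto_const_nhds (x := α⁻¹))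
          tendsto_inv_atTop_zero
          (add_pos_of_pos_of_nonneg (inv_pos.2 hα) le_rfl)
        refine ⟨L, hL.congr' ?_⟩
        filter_upwards [hpos] with t ht
        exact (Staircase.tableauProb_eq hα ht S).symm
    exact ⟨P, hP, hP.tendstoInDistribution hα (Eventually.of_forall fun _ => le_rfl)
      (eventually_ge_atTop α) hk⟩
  · obtain ⟨P, hP⟩ := Staircase.exists_isLimitLaw (α := fun t => t) (β := fun t => t) hpos hpos
      fun n S => by
        obtain ⟨L, hL⟩ := Staircase.tendsto_prob_self S
          (hpos.mono fun t ht => inv_pos.2 ht) tendsto_inv_atTop_zero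
        refine ⟨L, hL.congr' ?_⟩
        filter_upwards [hpos] with t ht
        exact (Staircase.tableauProb_eq ht ht S).symm
    exact ⟨P, hP, hP.tendstoInDistribution one_pos (eventually_ge_atTop 1)
      (eventually_ge_atTop 1) hk⟩
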